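/- Let $M$ be an oriented smooth 2-dimensional manifold with a smooth pseudo-Riemannian metric $g$ of any signature, with Levi-Civita connection having Christoffel symbols $\Gamma^i_{jl}$, and let $m\in\mathbb R$. All coordinate formulas refer to positively oriented charts (the charts of an oriented atlas). $\epsilon_{ij}$ is the skew-symmetric symbol with $\epsilon_{12}=1$, $a\cdot b=g_{ij}a^ib^j$, $\|a\|=\sqrt{|a\cdot a|}$, and $(*a)_j=\sqrt{|\det g|}\,\epsilon_{ij}a^i$. A regular curve is a smooth curve $x(\varsigma)$ on an open interval whose velocity $u=\dot x$ satisfies $u\cdot u\neq0$ everywhere (in the Riemannian case, an immersed curve). A prime is the covariant derivative along the curve, so $u'^i=\ddot x^i+\Gamma^i_{jl}u^ju^l$. The signed Frenet curvature is $$k=\frac{\sqrt{|\det g|}\,\epsilon_{ij}u^iu'^j}{\|u\|^3},$$ and a geodesic circle is a regular curve along which $k$ is constant. Consider the second order Lagrange function $L^R=k-m\|u\|$, a function of $(x,u,\dot u)$. Its Euler–Poisson expression along a regular curve is the covector $$E_i=\frac{\partial L^R}{\partial x^i}-\frac{d}{d\varsigma}\frac{\partial L^R}{\partial u^i}+\frac{d^2}{d\varsigma^2}\frac{\partial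 L^R}{\partial \dot u^i},$$ and a regular curve is an extremal if $E_i=0$ along it. Then, for every regular curve: 1. The Euler–Poisson expression is, with $\sigma=\operatorname{sgn}(u\cdot u)$ (so $\sigma=1$ if $g$ is Riemannian) and $u_j$, $u'_j$ denoting the lowered components, $$E_j=-\frac{(*u'')_j}{\|u\|^3}+3\sigma\,\frac{u\cdot u'}{\|u\|^5}\,(*u')_j+m\,\frac{(u\cdot u)\,u'_j-(u'\cdot u)\,u_j}{\|u\|^3}-\mathcal R_j,\qquad \mathcal R_j=\frac{\sqrt{|\det g|}}{\|u\|^3}\,\epsilon_{il}\,R_{jn,p}{}^{l}\,u^iu^pu^n,$$ where $R_{jn,p}{}^l$ is the component along $\partial_l$ of $(\nabla_n\nabla_j-\nabla_j\nabla_n)\partial_p$; $\mathcal R$ is the "spin" force term. 2. If the curve is an extremal, then its signed Frenet curvature is constant, i.e. it is a geodesic circle. 3. The curve is a geodesic circle if and only if, near each of its parameter values, it becomes an extremal after a suitable smooth orientation-preserving reparametrization: for every $\varsigma_0$ in its interval $I$ there are an open interval $J$ and a smooth $\theta:J\to I$ with $\theta'>0$ and $\varsigma_0\in\theta(J)$ such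 that $x\circ\theta$ is an extremal. -/

import Mathlib

open scoped Manifold ContDiff

noncomputable section

namespace Concircular

/-- The coordinate plane on which surfaces are modelled. -/
abbrev R2 : Type := EuclideanSpace ℝ (Fin 2)

/-! ### Coordinate expressions

In this part `G` is the matrix `y ↦ (g_{ij}(y))` of a metric in some chart, `y` is a point, and
tangent vectors are given by their components. -/

/-- The partial derivative `∂_i f (y)`. -/
def pd (i : Fin 2) (f : R2 → ℝ) (y : R2) : ℝ := fderiv ℝ f y (EuclideanSpace.single i 1)

/-- The skew-symmetric Levi-Civita symbol, `ε_{01} = 1`. -/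
def eps (i j : Fin 2) : ℝ := !![0, 1; -1, 0] i j

/-- The scalar product `a · b = g_{ij} a^i b^j`. -/
def dot (G : R2 → Matrix (Fin 2) (Fin 2) ℝ) (y a b : R2) : ℝ :=
  ∑ i, ∑ j, G y i j * a i * b j

/-- The covariant components `a_j = g_{ij} a^i`. -/
def lower (G : R2 → Matrix (Fin 2) (Fin 2) ℝ) (y a : R2) (j : Fin 2) : ℝ :=
  ∑ i, G y i j * a i

/-- `‖a‖ = √|a · a|`. -/
def vnorm (G : R2 → Matrix (Fin 2) (Fin 2) ℝ) (y a : R2) : ℝ := √|dot G y a a|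

/-- The factor `√|det g_{ij}|`. -/
def density (G : R2 → Matrix (Fin 2) (Fin 2) ℝ) (y : R2) : ℝ := √|(G y).det|

/-- The signed size of the bivector `a ∧ b`, that is `√|det g| ε_{ij} a^i b^j`. -/
def area (G : R2 → Matrix (Fin 2) (Fin 2) ℝ) (y a b : R2) : ℝ :=
  density G y * ∑ i, ∑ j, eps i j * a i * b j

/-- The Hodge star of a vector, the covector `(* a)_j = √|det g| ε_{ij} a^i`. -/
def star (G : R2 → Matrix (Fin 2) (Fin 2) ℝ) (y a : R2) (j : Fin 2) : ℝ :=
  density G y * ∑ i, eps i j * a i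

/-- The Christoffel symbols of the Levi-Civita connection; `christoffel G y i j l` is
`Γ^i_{jl} = ½ g^{ip} (∂_j g_{pl} + ∂_l g_{pj} - ∂_p g_{jl})`. -/
def christoffel (G : R2 → Matrix (Fin 2) (Fin 2) ℝ) (y : R2) (i j l : Fin 2) : ℝ :=
  (1 / 2) * ∑ p, (G y)⁻¹ i p *
    (pd j (fun z => G z p l) y + pd l (fun z => G z p j) y - pd p (fun z => G z j l) y)

/-- The Riemann tensor; `riemann G y j i p l` is `R_{ji,p}{}^l`, the component along `∂_l` of
`∇_i ∇_j ∂_p - ∇_j ∇_i ∂_p`. -/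
def riemann (G : R2 → Matrix (Fin 2) (Fin 2) ℝ) (y : R2) (j i p l : Fin 2) : ℝ :=
  pd i (fun z => christoffel G z l j p) y - pd j (fun z => christoffel G z l i p) y
    + ∑ q, (christoffel G y l i q * christoffel G y q j p
        - christoffel G y l j q * christoffel G y q i p)

/-- The covariant acceleration `u'` of a curve, as a function of its 2-jet `(y, u, w)` where `u`
and `w` are the first and the second derivatives of the coordinates:
`u'^i = w^i + Γ^i_{jl} u^j u^l`. -/
def covAcc (G : R2 → Matrix (Fin 2) (Fin 2) ℝ) (y u w : R2) : R2 :=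
  WithLp.toLp 2 fun i => w i + ∑ j, ∑ l, christoffel G y i j l * u j * u l

/-- The signed Frenet curvature `k = √|det g| ε_{ij} u^i u'^j / ‖u‖³` on 2-jets. -/
def frenet (G : R2 → Matrix (Fin 2) (Fin 2) ℝ) (y u w : R2) : ℝ :=
  area G y u (covAcc G y u w) / vnorm G y u ^ 3

/-- The Lagrange function `L^R = k - m ‖u‖` on 2-jets. -/
def lagrangian (m : ℝ) (G : R2 → Matrix (Fin 2) (Fin 2) ℝ) (y u w : R2) : ℝ :=
  frenet G y u w - m * vnorm G y u

/-- The `i`-th Euler-Poisson expression (Lagrange derivative) of a second order Lagrange function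
`L (x, u, w)` along a curve `c`:
`∂L/∂x^i - d/dt (∂L/∂u^i) + d²/dt² (∂L/∂w^i)`, where `u = dc/dt` and `w = d²c/dt²`. -/
def eulerPoisson (L : R2 → R2 → R2 → ℝ) (c : ℝ → R2) (t : ℝ) (i : Fin 2) : ℝ :=
  pd i (fun x => L x (deriv c t) (deriv (deriv c) t)) (c t)
    - deriv (fun s => pd i (fun u => L (c s) u (deriv (deriv c) s)) (deriv c s)) t
    + deriv (deriv fun s =>
        pd i (fun w => L (c s) (deriv c s) w) (deriv (deriv c) s)) t

/-- The covariant derivative along the curve `c` of a vector field `V` along `c`. -/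
def covD (G : R2 → Matrix (Fin 2) (Fin 2) ℝ) (c V : ℝ → R2) (t : ℝ) : R2 :=
  WithLp.toLp 2 fun i =>
    deriv V t i + ∑ j, ∑ l, christoffel G (c t) i j l * deriv c t j * V t l

/-- The spin force `𝓡_j = √|det g| ‖u‖⁻³ ε_{il} R_{jn,p}{}^l u^i u^p u^n`. -/
def spinForce (G : R2 → Matrix (Fin 2) (Fin 2) ℝ) (y u : R2) (j : Fin 2) : ℝ :=
  density G y / vnorm G y u ^ 3 *
    ∑ i, ∑ l, ∑ n, ∑ p, eps i l * riemann G y j n p l * u i * u p * u n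

/-- The covector `E^R` along a curve `c`, with components
`-(* u'')_j / ‖u‖³ + 3 σ (u · u') (* u')_j / ‖u‖⁵ + m ((u · u) u'_j - (u' · u) u_j) / ‖u‖³ - 𝓡_j`,
where `σ` is the sign of `u · u` (so `σ = 1` for a Riemannian metric). -/
def eulerPoissonR (m : ℝ) (G : R2 → Matrix (Fin 2) (Fin 2) ℝ) (c : ℝ → R2) (t : ℝ)
    (j : Fin 2) : ℝ :=
  let y := c t
  let u := deriv c t
  let u₁ := covD G c (deriv c) t
  let u₂ := covD G c (covD G c (deriv c)) t
  let N := vnorm G y u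
  (-star G y u₂ j / N ^ 3)
    + 3 * Real.sign (dot G y u u) * dot G y u u₁ / N ^ 5 * star G y u₁ j
    + m * ((dot G y u u * lower G y u₁ j - dot G y u₁ u * lower G y u j) / N ^ 3)
    - spinForce G y u j

/-! ### Oriented pseudo-Riemannian surfaces -/

section Surface

/-- A smooth pseudo-Riemannian metric, of any signature, on a smooth surface `M`: a field of
nondegenerate symmetric bilinear forms on the tangent spaces whose components in every smooth
chart are smooth. -/
structure PseudoMetric (M : Type*) [TopologicalSpace M] [ChartedSpace R2 M] where
  val : ∀ x : M, LinearMap.BilinForm ℝ (TangentSpace 𝓘(ℝ, R2) x)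
  symm : ∀ x v w, val x v w = val x w v
  nondegenerate : ∀ x v, (∀ w, val x v w = 0) → v = 0
  smooth : ∀ φ ∈ IsManifold.maximalAtlas 𝓘(ℝ, R2) ∞ M, ∀ i j : Fin 2,
    ContDiffOn ℝ ∞
      (fun y : R2 => val (φ.symm y)
        (mfderiv 𝓘(ℝ, R2) 𝓘(ℝ, R2) φ.symm y (EuclideanSpace.single i (1 : ℝ)))
        (mfderiv 𝓘(ℝ, R2) 𝓘(ℝ, R2) φ.symm y (EuclideanSpace.single j (1 : ℝ)))) φ.target

/-- An orientation of a smooth surface, given by an oriented atlas: a set of smooth charts that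
cover `M` and have transition maps with positive Jacobian. -/
structure OrientedAtlas (M : Type*) [TopologicalSpace M] [ChartedSpace R2 M] where
  charts : Set (OpenPartialHomeomorph M R2)
  smooth : charts ⊆ IsManifold.maximalAtlas 𝓘(ℝ, R2) ∞ M
  cover : ∀ x : M, ∃ φ ∈ charts, x ∈ φ.source
  det_pos : ∀ φ ∈ charts, ∀ ψ ∈ charts, ∀ y ∈ (φ.symm.trans ψ).source,
    0 < (fderiv ℝ (φ.symm.trans ψ) y).det

variable {M : Type*} [TopologicalSpace M] [ChartedSpace R2 M]

/-- The components `g_{ij}` of the metric in the chart `φ`. -/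
def PseudoMetric.comp (g : PseudoMetric M) (φ : OpenPartialHomeomorph M R2) (y : R2) :
    Matrix (Fin 2) (Fin 2) ℝ :=
  Matrix.of fun i j => g.val (φ.symm y)
    (mfderiv 𝓘(ℝ, R2) 𝓘(ℝ, R2) φ.symm y (EuclideanSpace.single i (1 : ℝ)))
    (mfderiv 𝓘(ℝ, R2) 𝓘(ℝ, R2) φ.symm y (EuclideanSpace.single j (1 : ℝ)))

/-- The signed Frenet curvature at the parameter value `t` of the curve `γ`, computed in the
chart `φ`. -/
def curvatureAt (g : PseudoMetric M) (φ : OpenPartialHomeomorph M R2) (γ : ℝ → M) (t : ℝ) : ℝ :=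
  frenet (g.comp φ) (φ (γ t)) (deriv (φ ∘ γ) t) (deriv (deriv (φ ∘ γ)) t)

/-- A smooth curve over `I` whose velocity is nowhere null (for a Riemannian metric: an immersed
curve). -/
structure IsRegularCurve (g : PseudoMetric M) (o : OrientedAtlas M) (γ : ℝ → M) (I : Set ℝ) :
    Prop where
  smooth : ContMDiffOn 𝓘(ℝ, ℝ) 𝓘(ℝ, R2) ∞ γ I
  nonnull : ∀ φ ∈ o.charts, ∀ t ∈ I, γ t ∈ φ.source →
    dot (g.comp φ) (φ (γ t)) (deriv (φ ∘ γ) t) (deriv (φ ∘ γ) t) ≠ 0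

/-- An extremal of `L^R = k - m ‖u‖`: a regular curve that satisfies the Euler-Poisson equation
in all charts of the oriented atlas. -/
structure IsExtremal (m : ℝ) (g : PseudoMetric M) (o : OrientedAtlas M) (γ : ℝ → M)
    (I : Set ℝ) : Prop where
  regular : IsRegularCurve g o γ I
  eq_zero : ∀ φ ∈ o.charts, ∀ t ∈ I, γ t ∈ φ.source →
    ∀ i, eulerPoisson (lagrangian m (g.comp φ)) (φ ∘ γ) t i = 0

/-- A geodesic circle: a regular curve along which the signed Frenet curvature is constant. -/
structure IsGeodesicCircle (g : PseudoMetric M) (o : OrientedAtlas M) (γ : ℝ → M) (I : Set ℝ) :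
    Prop where
  regular : IsRegularCurve g o γ I
  const : ∃ κ : ℝ, ∀ φ ∈ o.charts, ∀ t ∈ I, γ t ∈ φ.source → curvatureAt g φ γ t = κ

end Surface

end Concircular

end

namespace Concircular

/-! The theorem rests on one identity: contracting the Euler–Poisson expression with the velocity
gives `E_j u^j = dk/dς`. In the closed formula for `E`, the `m`-term and the curvature term vanish
on `u`, and what remains is the derivative of `k = area(u, u') / ‖u‖³`
(`LocalCurve.hasDerivAt_curveCurvature`). Hence `k` is constant on extremals.

For the converse, `E` is a covector in the plane, so it vanishes once it vanishes on `u` and on one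
transversal vector. On `u` it is `dk/dς`, which is zero for a geodesic circle in every
parametrization. After a change of parameter `θ`, the third derivative `θ'''` enters only through
the summand `θ''' u` of the new `u''`. The transversal component of `E` is therefore affine in
`θ'''` with nonzero coefficient, and its vanishing is a third order ODE for `θ`, solvable locally
with `θ' > 0` (`LocalCurve.exists_reparam`). In the other direction, invariance of `k` gives `(k ∘
θ)' = 0`, and `θ' > 0` yields `k' = 0`.

The closed formula (`LocalCurve.eulerPoisson_eq`) is a computation in one chart. Since `k` is affine
in the acceleration, `p = ∂L/∂w` depends on position and velocity only. One finds `∂L/∂u = ṗ - Q`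
with `Q` explicit, so `E = ∂L/∂x + Q̇` and `p̈` is never computed. Metric compatibility turns
derivatives of `dot` and `area` into covariant ones, and the leftover Christoffel terms combine into
the curvature.

Finally, transition maps of the oriented atlas are orientation-preserving isometries
(`PseudoMetric.localIsometry`), under which `k` is invariant and `E` covariant, so a statement
proved in one chart holds in all. -/

/-! ### Metrics on open subsets of the plane -/

/-- The standard basis vectors of the coordinate plane. -/
noncomputable abbrev std (i : Fin 2) : R2 := EuclideanSpace.single i (1 : ℝ)

/-- `G` is the component matrix of a smooth pseudo-Riemannian metric on the open set `U`. -/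
structure LocalMetric (G : R2 → Matrix (Fin 2) (Fin 2) ℝ) (U : Set R2) : Prop where
  isOpen : IsOpen U
  symm : ∀ y i j, G y i j = G y j i
  smooth : ∀ i j, ContDiffOn ℝ ∞ (fun y => G y i j) U
  det_ne : ∀ y ∈ U, (G y).det ≠ 0

/-- The vector `Γ(a, b)` with components `Γ^i_{jl} a^j b^l`. -/
noncomputable def chr (G : R2 → Matrix (Fin 2) (Fin 2) ℝ) (y a b : R2) : R2 :=
  WithLp.toLp 2 fun i => ∑ j, ∑ l, christoffel G y i j l * a j * b l

/-- The derivative of `Γ(a, b)` in the direction `e`, with `a` and `b` constant. -/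
noncomputable def dchr (G : R2 → Matrix (Fin 2) (Fin 2) ℝ) (y e a b : R2) : R2 :=
  WithLp.toLp 2 fun i =>
    ∑ j, ∑ l, fderiv ℝ (fun z => christoffel G z i j l) y e * a j * b l

theorem std_zero_zero : std 0 0 = 1 := by simp [std]

theorem std_zero_one : std 0 1 = 0 := by simp [std]

theorem std_one_zero : std 1 0 = 0 := by simp [std]

theorem std_one_one : std 1 1 = 1 := by simp [std]

theorem R2.eq_sum (a : R2) : a = a 0 • std 0 + a 1 • std 1 := by
  ext i; fin_cases i <;> simp [std]

theorem ContDiffOn.pd {f : R2 → ℝ} {U : Set R2} (hU : IsOpen U) (hf : ContDiffOn ℝ ∞ f U)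
    (i : Fin 2) : ContDiffOn ℝ ∞ (pd i f) U :=
  (hf.fderiv_of_isOpen hU (m := ∞) (by simp)).clm_apply contDiffOn_const

section Expand

variable (G : R2 → Matrix (Fin 2) (Fin 2) ℝ) (y a b e : R2)

theorem dot_expand : dot G y a b =
    G y 0 0 * a 0 * b 0 + G y 0 1 * a 0 * b 1 + (G y 1 0 * a 1 * b 0 + G y 1 1 * a 1 * b 1) := by
  simp [dot, Fin.sum_univ_two]

theorem area_expand : area G y a b = density G y * (a 0 * b 1 - a 1 * b 0) := by
  simp only [area, eps, Fin.sum_univ_two]; simp; left; ring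

theorem star_eq_area (j : Fin 2) : star G y a j = area G y a (std j) := by
  fin_cases j <;> simp [area, star, eps, Fin.sum_univ_two, std]

theorem lower_eq_dot (j : Fin 2) : lower G y a j = dot G y a (std j) := by
  fin_cases j <;> simp [dot, lower, Fin.sum_univ_two, std]

theorem chr_apply (i : Fin 2) : chr G y a b i =
    christoffel G y i 0 0 * a 0 * b 0 + christoffel G y i 0 1 * a 0 * b 1
      + (christoffel G y i 1 0 * a 1 * b 0 + christoffel G y i 1 1 * a 1 * b 1) := by
  simp [chr, Fin.sum_univ_two]

theorem dchr_apply (i : Fin 2) : dchr G y e a b i =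
    fderiv ℝ (fun z => christoffel G z i 0 0) y e * a 0 * b 0
      + fderiv ℝ (fun z => christoffel G z i 0 1) y e * a 0 * b 1
      + (fderiv ℝ (fun z => christoffel G z i 1 0) y e * a 1 * b 0
      + fderiv ℝ (fun z => christoffel G z i 1 1) y e * a 1 * b 1) := by
  simp [dchr, Fin.sum_univ_two]

theorem covAcc_eq (u w : R2) : covAcc G y u w = w + chr G y u u := by
  ext i; simp [covAcc, chr]

theorem covD_eq (c V : ℝ → R2) (t : ℝ) :
    covD G c V t = deriv V t + chr G (c t) (deriv c t) (V t) := by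
  ext i; simp [covD, chr]

theorem area_self : area G y a a = 0 := by rw [area_expand]; ring

/-- The two-dimensional cyclic identity. -/
theorem area_mul_dot (u v w : R2) : area G y u v * dot G y u w =
    area G y u w * dot G y u v - area G y v w * dot G y u u := by
  -- Three vectors in the plane satisfy `area(u,v) w + area(v,w) u + area(w,u) v = 0`; this is the
  -- scalar product of that relation with `u`.
  simp only [area_expand, dot_expand]; ring

end Expand

namespace LocalMetric

variable {G : R2 → Matrix (Fin 2) (Fin 2) ℝ} {U : Set R2} (h : LocalMetric G U)
include h

theorem dot_comm (y a b : R2) : dot G y a b = dot G y b a := by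
  simp only [dot_expand, h.symm y 1 0]; ring

theorem contDiffAt_comp {y : R2} (hy : y ∈ U) (i j : Fin 2) :
    ContDiffAt ℝ ∞ (fun z => G z i j) y :=
  (h.smooth i j).contDiffAt (h.isOpen.mem_nhds hy)

theorem contDiffOn_inv (i j : Fin 2) : ContDiffOn ℝ ∞ (fun y => (G y)⁻¹ i j) U := by
  have hdet : ContDiffOn ℝ ∞ (fun y => (G y).det) U := by
    simp only [Matrix.det_fin_two]
    exact ((h.smooth 0 0).mul (h.smooth 1 1)).sub ((h.smooth 0 1).mul (h.smooth 1 0))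
  have hinv := hdet.inv h.det_ne
  have : (fun y => (G y)⁻¹ i j) = fun y => (G y).det⁻¹ * (G y).adjugate i j := by
    funext y; simp [Matrix.inv_def]
  rw [this]
  refine hinv.mul ?_
  simp only [Matrix.adjugate_fin_two]
  fin_cases i <;> fin_cases j <;> simp
  · exact h.smooth 1 1
  · exact (h.smooth 0 1).neg
  · exact (h.smooth 1 0).neg
  · exact h.smooth 0 0

theorem contDiffOn_christoffel (i j l : Fin 2) :
    ContDiffOn ℝ ∞ (fun y => christoffel G y i j l) U := by
  unfold christoffel
  refine contDiffOn_const.mul (ContDiffOn.sum fun p _ => (h.contDiffOn_inv i p).mul ?_)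
  exact ((ContDiffOn.pd h.isOpen (h.smooth _ _) _).add
    (ContDiffOn.pd h.isOpen (h.smooth _ _) _)).sub (ContDiffOn.pd h.isOpen (h.smooth _ _) _)

theorem contDiffAt_christoffel {y : R2} (hy : y ∈ U) (i j l : Fin 2) :
    ContDiffAt ℝ ∞ (fun z => christoffel G z i j l) y :=
  (h.contDiffOn_christoffel i j l).contDiffAt (h.isOpen.mem_nhds hy)

theorem christoffel_comm (y : R2) (i j l : Fin 2) :
    christoffel G y i j l = christoffel G y i l j := by
  -- Symmetry is assumed at every point, so the two components agree as functions and may be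
  -- exchanged under `pd`.
  have hs : (fun z => G z j l) = fun z => G z l j := funext fun z => h.symm z j l
  unfold christoffel
  rw [hs]
  congr 1
  refine Finset.sum_congr rfl fun p _ => ?_
  ring

theorem chr_comm (y a b : R2) : chr G y a b = chr G y b a := by
  ext i
  simp only [chr_apply, h.christoffel_comm y i 1 0]; ring

theorem dchr_comm (y e a b : R2) : dchr G y e a b = dchr G y e b a := by
  ext i
  have : (fun z => christoffel G z i 1 0) = fun z => christoffel G z i 0 1 :=
    funext fun z => h.christoffel_comm z i 1 0
  simp only [dchr_apply, this]; ring

/-- The Christoffel symbols of the first kind. -/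
theorem sum_mul_christoffel {y : R2} (hy : y ∈ U) (p j l : Fin 2) :
    ∑ i, G y p i * christoffel G y i j l = (1 / 2) *
      (pd j (fun z => G z p l) y + pd l (fun z => G z p j) y - pd p (fun z => G z j l) y) := by
  have hinv : G y * (G y)⁻¹ = 1 := Matrix.mul_nonsing_inv _ (h.det_ne y hy).isUnit
  set K : Fin 2 → ℝ := fun q =>
    pd j (fun z => G z q l) y + pd l (fun z => G z q j) y - pd q (fun z => G z j l) y with hK
  have : (G y).mulVec ((G y)⁻¹.mulVec K) = K := by
    rw [Matrix.mulVec_mulVec, hinv, Matrix.one_mulVec]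
  have hp := congrFun this p
  simp only [Matrix.mulVec, dotProduct, Fin.sum_univ_two] at hp
  simp only [christoffel, Fin.sum_univ_two]
  simp only [hK] at hp
  linear_combination (1 / 2) * hp

/-- Metric compatibility of the Levi-Civita connection, in components. -/
theorem pd_comp {y : R2} (hy : y ∈ U) (k i j : Fin 2) :
    pd k (fun z => G z i j) y =
      dot G y (chr G y (std k) (std i)) (std j) + dot G y (std i) (chr G y (std k) (std j)) := by
  have h1 := h.sum_mul_christoffel hy j k i
  have h2 := h.sum_mul_christoffel hy i k j
  have hs : ∀ p q, (fun z => G z p q) = fun z => G z q p :=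
    fun p q => funext fun z => h.symm z p q
  rw [hs j i, hs k i] at h1
  rw [hs k j] at h2
  have e1 : dot G y (chr G y (std k) (std i)) (std j) =
      ∑ q, G y j q * christoffel G y q k i := by
    have := h.symm y 0 1
    fin_cases k <;> fin_cases i <;> fin_cases j <;>
      simp [dot_expand, chr_apply, std, Fin.sum_univ_two, this]
  have e2 : dot G y (std i) (chr G y (std k) (std j)) =
      ∑ q, G y i q * christoffel G y q k j := by
    fin_cases k <;> fin_cases i <;> fin_cases j <;>
      simp [dot_expand, chr_apply, std, Fin.sum_univ_two]
  rw [e1, e2, h1, h2]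
  ring

end LocalMetric
/-! ### Smoothness and derivatives of the geometric quantities along paths -/

theorem _root_.HasDerivAt.coord {f : ℝ → R2} {f' : R2} {t : ℝ} (hf : HasDerivAt f f' t)
    (i : Fin 2) : HasDerivAt (fun s => f s i) (f' i) t :=
  (EuclideanSpace.proj i : R2 →L[ℝ] ℝ).hasFDerivAt.comp_hasDerivAt t hf

theorem hasDerivAt_of_coord {f : ℝ → R2} {f' : R2} {t : ℝ}
    (hf : ∀ i, HasDerivAt (fun s => f s i) (f' i) t) : HasDerivAt f f' t := by
  exact ((PiLp.continuousLinearEquiv 2 ℝ (fun _ : Fin 2 => ℝ)).symm.hasFDerivAt.comp_hasDerivAt t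
    (hasDerivAt_pi.2 hf))

theorem fderiv_eq_pd {f : R2 → ℝ} {y : R2} (v : R2) :
    fderiv ℝ f y v = v 0 * pd 0 f y + v 1 * pd 1 f y := by
  conv_lhs => rw [R2.eq_sum v]
  simp [pd]

/-- A partial derivative is a derivative along a coordinate line. Thus one formula for the Lagrange
function along a path of 2-jets yields all three of its partial gradients, by keeping two of the
slots constant. -/
theorem pd_eq_of_hasDerivAt {f : R2 → ℝ} {y : R2} {i : Fin 2} {d : ℝ}
    (hf : DifferentiableAt ℝ f y) (hd : HasDerivAt (fun s : ℝ => f (y + s • std i)) d 0) :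
    pd i f y = d := by
  have h1 : HasDerivAt (fun s : ℝ => y + s • std i) (std i) 0 := by
    simpa using ((hasDerivAt_id (0 : ℝ)).smul_const (std i)).const_add y
  have h2 : HasFDerivAt f (fderiv ℝ f y) (y + (0 : ℝ) • std i) := by simpa using hf.hasFDerivAt
  exact (h2.comp_hasDerivAt (0 : ℝ) h1).unique hd

theorem sign_mul_self (x : ℝ) : Real.sign x * x = |x| := by
  rcases lt_trichotomy x 0 with h | h | h
  · rw [Real.sign_of_neg h, abs_of_neg h]; ring
  · simp [h]
  · rw [Real.sign_of_pos h, abs_of_pos h, one_mul]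

/-- Off zero, `|f|` has derivative `sign f * f'`. Keeping the sign as a factor treats all signatures
at once. -/
theorem hasDerivAt_sqrt_abs {f : ℝ → ℝ} {f' t : ℝ} (hf : HasDerivAt f f' t) (h0 : f t ≠ 0) :
    HasDerivAt (fun s => √|f s|) (Real.sign (f t) * f' / (2 * √|f t|)) t := by
  have h1 := (hasDerivAt_abs h0).comp t hf
  refine (h1.sqrt (abs_ne_zero.2 h0)).congr_deriv ?_
  simp only [Function.comp_apply]
  rcases lt_or_gt_of_ne h0 with h | h
  · simp [Real.sign_of_neg h, h]
  · simp [Real.sign_of_pos h, h]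

section

variable {E : Type*} [NormedAddCommGroup E] [NormedSpace ℝ E] {x : E} {n : WithTop ℕ∞}

theorem _root_.ContDiffAt.coord {f : E → R2} (hf : ContDiffAt ℝ n f x) (i : Fin 2) :
    ContDiffAt ℝ n (fun z => f z i) x :=
  contDiffAt_euclidean.1 hf i

namespace LocalMetric

variable {G : R2 → Matrix (Fin 2) (Fin 2) ℝ} {U : Set R2} (h : LocalMetric G U)
include h
variable {y a b : E → R2} (hyU : y x ∈ U)
  (hy : ContDiffAt ℝ ∞ y x) (ha : ContDiffAt ℝ ∞ a x) (hb : ContDiffAt ℝ ∞ b x)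
include hyU hy

theorem contDiffAt_comp_path (i j : Fin 2) : ContDiffAt ℝ ∞ (fun z => G (y z) i j) x :=
  (h.contDiffAt_comp hyU i j).comp x hy

theorem contDiffAt_christoffel_path (i j l : Fin 2) :
    ContDiffAt ℝ ∞ (fun z => christoffel G (y z) i j l) x :=
  (h.contDiffAt_christoffel hyU i j l).comp x hy

theorem contDiffAt_density : ContDiffAt ℝ ∞ (fun z => density G (y z)) x := by
  have hdet : ContDiffAt ℝ ∞ (fun z => (G (y z)).det) x := by
    simp only [Matrix.det_fin_two]
    have := h.contDiffAt_comp_path hyU hy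
    exact ((this 0 0).mul (this 1 1)).sub ((this 0 1).mul (this 1 0))
  exact (hdet.abs (h.det_ne _ hyU)).sqrt (abs_ne_zero.2 (h.det_ne _ hyU))

include ha hb

theorem contDiffAt_dot : ContDiffAt ℝ ∞ (fun z => dot G (y z) (a z) (b z)) x :=
  ContDiffAt.sum fun i _ => ContDiffAt.sum fun j _ =>
    ((h.contDiffAt_comp_path hyU hy i j).mul (ha.coord i)).mul (hb.coord j)

theorem contDiffAt_area : ContDiffAt ℝ ∞ (fun z => area G (y z) (a z) (b z)) x :=
  (h.contDiffAt_density hyU hy).mul <| ContDiffAt.sum fun i _ => ContDiffAt.sum fun j _ =>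
    (contDiffAt_const.mul (ha.coord i)).mul (hb.coord j)

theorem contDiffAt_chr : ContDiffAt ℝ ∞ (fun z => chr G (y z) (a z) (b z)) x :=
  contDiffAt_euclidean.2 fun i => by
    simp only [chr]
    exact ContDiffAt.sum fun j _ => ContDiffAt.sum fun l _ =>
    ((h.contDiffAt_christoffel_path hyU hy i j l).mul (ha.coord j)).mul (hb.coord l)

omit hb

theorem contDiffAt_vnorm (h0 : dot G (y x) (a x) (a x) ≠ 0) :
    ContDiffAt ℝ ∞ (fun z => vnorm G (y z) (a z)) x :=
  ((h.contDiffAt_dot hyU hy ha ha).abs h0).sqrt (abs_ne_zero.2 h0)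

include hb

theorem contDiffAt_lagrangian (m : ℝ) (h0 : dot G (y x) (a x) (a x) ≠ 0) :
    ContDiffAt ℝ ∞ (fun z => lagrangian m G (y z) (a z) (b z)) x := by
  have hN := h.contDiffAt_vnorm hyU hy ha h0
  have hacc : ContDiffAt ℝ ∞ (fun z => covAcc G (y z) (a z) (b z)) x := by
    simp only [covAcc_eq]
    exact hb.add (h.contDiffAt_chr hyU hy ha ha)
  exact ((h.contDiffAt_area hyU hy ha hacc).div (hN.pow 3)
    (pow_ne_zero _ (Real.sqrt_ne_zero'.2 (abs_pos.2 h0)))).sub (contDiffAt_const.mul hN)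

end LocalMetric

end

/-! ### Derivatives of `density`, `dot`, `area`, `chr` and `vnorm` along paths -/

namespace LocalMetric

variable {G : R2 → Matrix (Fin 2) (Fin 2) ℝ} {U : Set R2} (h : LocalMetric G U)
include h
variable {y a b : ℝ → R2} {y' a' b' : R2} {t : ℝ} (hyU : y t ∈ U)
  (hy : HasDerivAt y y' t) (ha : HasDerivAt a a' t) (hb : HasDerivAt b b' t)
include hyU hy

theorem hasDerivAt_comp_path (i j : Fin 2) : HasDerivAt (fun s => G (y s) i j)
    (dot G (y t) (chr G (y t) y' (std i)) (std j)
      + dot G (y t) (std i) (chr G (y t) y' (std j))) t := by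
  have h1 := ((h.contDiffAt_comp hyU i j).differentiableAt (by simp)).hasFDerivAt.comp_hasDerivAt
    t hy
  refine h1.congr_deriv ?_
  rw [fderiv_eq_pd, h.pd_comp hyU, h.pd_comp hyU]
  simp only [dot_expand, chr_apply, std_zero_zero, std_zero_one, std_one_zero, std_one_one]
  ring

/-- Metric compatibility: the derivative of the density factor. -/
theorem hasDerivAt_density : HasDerivAt (fun s => density G (y s))
    (density G (y t) * (chr G (y t) y' (std 0) 0 + chr G (y t) y' (std 1) 1)) t := by
  have hG := h.hasDerivAt_comp_path hyU hy
  -- Metric compatibility makes the logarithmic derivative of the determinant twice the trace of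
  -- `Γ(y', ·)`; the square root halves it.
  have hdet : HasDerivAt (fun s => (G (y s)).det)
      ((G (y t)).det * (2 * (chr G (y t) y' (std 0) 0 + chr G (y t) y' (std 1) 1))) t := by
    simp only [Matrix.det_fin_two]
    refine (((hG 0 0).mul (hG 1 1)).sub ((hG 0 1).mul (hG 1 0))).congr_deriv ?_
    simp only [dot_expand, h.symm (y t) 1 0]
    simp [std]
    ring
  refine (hasDerivAt_sqrt_abs hdet (h.det_ne _ hyU)).congr_deriv ?_
  have h1 : Real.sign (G (y t)).det * (G (y t)).det = √|(G (y t)).det| * √|(G (y t)).det| := by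
    rw [Real.mul_self_sqrt (abs_nonneg _), sign_mul_self]
  have h2 : √|(G (y t)).det| ≠ 0 := Real.sqrt_ne_zero'.2 (abs_pos.2 (h.det_ne _ hyU))
  rw [← mul_assoc, h1, density]
  field_simp

include ha hb

/-- Metric compatibility: the derivative of scalar products along a path. -/
theorem hasDerivAt_dot : HasDerivAt (fun s => dot G (y s) (a s) (b s))
    (dot G (y t) (a' + chr G (y t) y' (a t)) (b t)
      + dot G (y t) (a t) (b' + chr G (y t) y' (b t))) t := by
  have hG := h.hasDerivAt_comp_path hyU hy
  simp only [dot_expand G (y _)]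
  refine (((((hG 0 0).mul (ha.coord 0)).mul (hb.coord 0)).add
    (((hG 0 1).mul (ha.coord 0)).mul (hb.coord 1))).add
    ((((hG 1 0).mul (ha.coord 1)).mul (hb.coord 0)).add
    (((hG 1 1).mul (ha.coord 1)).mul (hb.coord 1)))).congr_deriv ?_
  simp only [dot_expand, chr_apply, PiLp.add_apply]
  simp [std]
  ring

/-- The derivative of the area form along a path. -/
theorem hasDerivAt_area : HasDerivAt (fun s => area G (y s) (a s) (b s))
    (area G (y t) (a' + chr G (y t) y' (a t)) (b t)
      + area G (y t) (a t) (b' + chr G (y t) y' (b t))) t := by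
  -- The trace coming from the density is absorbed by `area(Aa, b) + area(a, Ab) = tr A * area(a,
  -- b)` for `A = Γ(y', ·)`.
  have hd := h.hasDerivAt_density hyU hy
  simp only [area_expand G (y _)]
  refine (hd.mul (((ha.coord 0).mul (hb.coord 1)).sub ((ha.coord 1).mul (hb.coord 0)))).congr_deriv ?_
  simp only [chr_apply, PiLp.add_apply]
  simp [std]
  ring

/-- The derivative of `Γ(a, b)` along a path. -/
theorem hasDerivAt_chr : HasDerivAt (fun s => chr G (y s) (a s) (b s))
    (dchr G (y t) y' (a t) (b t) + chr G (y t) a' (b t) + chr G (y t) (a t) b') t := by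
  have hC : ∀ i j l, HasDerivAt (fun s => christoffel G (y s) i j l)
      (fderiv ℝ (fun z => christoffel G z i j l) (y t) y') t := fun i j l =>
    ((h.contDiffAt_christoffel hyU i j l).differentiableAt
      (by simp)).hasFDerivAt.comp_hasDerivAt t hy
  refine hasDerivAt_of_coord fun i => ?_
  simp only [chr_apply G (y _)]
  refine (((((hC i 0 0).mul (ha.coord 0)).mul (hb.coord 0)).add
    (((hC i 0 1).mul (ha.coord 0)).mul (hb.coord 1))).add
    ((((hC i 1 0).mul (ha.coord 1)).mul (hb.coord 0)).add
    (((hC i 1 1).mul (ha.coord 1)).mul (hb.coord 1)))).congr_deriv ?_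
  simp only [chr_apply, dchr_apply, PiLp.add_apply, Pi.mul_apply]
  ring

omit hb

theorem hasDerivAt_vnorm (h0 : dot G (y t) (a t) (a t) ≠ 0) :
    HasDerivAt (fun s => vnorm G (y s) (a s))
    (Real.sign (dot G (y t) (a t) (a t)) * dot G (y t) (a t) (a' + chr G (y t) y' (a t))
      / vnorm G (y t) (a t)) t := by
  refine (hasDerivAt_sqrt_abs (h.hasDerivAt_dot hyU hy ha ha) h0).congr_deriv ?_
  rw [h.dot_comm _ (a' + _)]
  unfold vnorm
  ring

end LocalMetric
/-! ### The Euler-Poisson expression of `k - m ‖u‖` in a chart -/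

section Bilinear

variable (G : R2 → Matrix (Fin 2) (Fin 2) ℝ) (y a a' b b' e : R2) (r : ℝ)

theorem area_add_left : area G y (a + a') b = area G y a b + area G y a' b := by
  simp only [area_expand, PiLp.add_apply]; ring

theorem area_add_right : area G y a (b + b') = area G y a b + area G y a b' := by
  simp only [area_expand, PiLp.add_apply]; ring

theorem area_smul_left : area G y (r • a) b = r * area G y a b := by
  simp only [area_expand, PiLp.smul_apply, smul_eq_mul]; ring

theorem area_smul_right : area G y a (r • b) = r * area G y a b := by
  simp only [area_expand, PiLp.smul_apply, smul_eq_mul]; ring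

theorem area_swap : area G y a b = -area G y b a := by
  simp only [area_expand]; ring

theorem dot_add_left : dot G y (a + a') b = dot G y a b + dot G y a' b := by
  simp only [dot_expand, PiLp.add_apply]; ring

theorem dot_smul_left : dot G y (r • a) b = r * dot G y a b := by
  simp only [dot_expand, PiLp.smul_apply, smul_eq_mul]; ring

theorem dot_smul_right : dot G y a (r • b) = r * dot G y a b := by
  simp only [dot_expand, PiLp.smul_apply, smul_eq_mul]; ring

theorem chr_add_right : chr G y a (b + b') = chr G y a b + chr G y a b' := by
  ext i; simp only [chr_apply, PiLp.add_apply]; ring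

theorem chr_smul_left : chr G y (r • a) b = r • chr G y a b := by
  ext i; simp only [chr_apply, PiLp.smul_apply, smul_eq_mul]; ring

theorem chr_smul_right : chr G y a (r • b) = r • chr G y a b := by
  ext i; simp only [chr_apply, PiLp.smul_apply, smul_eq_mul]; ring

theorem chr_zero_left : chr G y 0 b = 0 := by
  ext i; simp [chr_apply]

theorem chr_zero_right : chr G y a 0 = 0 := by
  ext i; simp [chr_apply]

theorem dchr_zero_left : dchr G y 0 a b = 0 := by
  ext i; simp [dchr_apply]

end Bilinear

/-- The curvature vector `R(b, a) v` with components `R_{jn,p}{}^l a^j b^n v^p`. -/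
noncomputable def curv (G : R2 → Matrix (Fin 2) (Fin 2) ℝ) (y a b v : R2) : R2 :=
  dchr G y b a v - dchr G y a b v + chr G y b (chr G y a v) - chr G y a (chr G y b v)

/-- The expression `E^R` evaluated on a vector `v`, as a function of the position `y`, the
velocity `u` and its first two covariant derivatives `u₁` and `u₂`. -/
noncomputable def forceForm (m : ℝ) (G : R2 → Matrix (Fin 2) (Fin 2) ℝ) (y u u₁ u₂ v : R2) : ℝ :=
  -area G y u₂ v / vnorm G y u ^ 3
    + 3 * Real.sign (dot G y u u) * dot G y u u₁ / vnorm G y u ^ 5 * area G y u₁ v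
    + m * ((dot G y u u * dot G y u₁ v - dot G y u₁ u * dot G y u v) / vnorm G y u ^ 3)
    - area G y u (curv G y v u u) / vnorm G y u ^ 3

theorem dchr_expand (G : R2 → Matrix (Fin 2) (Fin 2) ℝ) (y e a b : R2) (i : Fin 2) :
    dchr G y e a b i = ∑ k, ∑ j, ∑ l,
      pd k (fun z => christoffel G z i j l) y * e k * a j * b l := by
  simp only [dchr_apply, fderiv_eq_pd, Fin.sum_univ_two]
  ring

theorem sum_riemann (G : R2 → Matrix (Fin 2) (Fin 2) ℝ) (y u : R2) (j l : Fin 2) :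
    ∑ n, ∑ p, riemann G y j n p l * u p * u n = curv G y (std j) u u l := by
  simp only [curv, PiLp.add_apply, PiLp.sub_apply, dchr_expand, chr_apply, riemann,
    Fin.sum_univ_two]
  fin_cases j <;>
  simp only [Fin.mk_zero, Fin.mk_one, std_zero_zero, std_zero_one, std_one_zero,
    std_one_one] <;> ring

theorem spinForce_eq (G : R2 → Matrix (Fin 2) (Fin 2) ℝ) (y u : R2) (j : Fin 2) :
    spinForce G y u j = area G y u (curv G y (std j) u u) / vnorm G y u ^ 3 := by
  simp only [spinForce, area, ← sum_riemann, Fin.sum_univ_two, eps]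
  ring

theorem eulerPoissonR_eq (m : ℝ) (G : R2 → Matrix (Fin 2) (Fin 2) ℝ) (c : ℝ → R2) (t : ℝ)
    (j : Fin 2) : eulerPoissonR m G c t j =
      forceForm m G (c t) (deriv c t) (covD G c (deriv c) t)
        (covD G c (covD G c (deriv c)) t) (std j) := by
  simp only [eulerPoissonR, forceForm, star_eq_area, lower_eq_dot, spinForce_eq]

/-- `c` is a smooth curve over the open set `T` in the domain `U` of the metric `G`, with nowhere
null velocity. -/
structure LocalCurve (G : R2 → Matrix (Fin 2) (Fin 2) ℝ) (U : Set R2) (c : ℝ → R2)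
    (T : Set ℝ) : Prop where
  isOpen : IsOpen T
  smooth : ContDiffOn ℝ ∞ c T
  mapsTo : ∀ t ∈ T, c t ∈ U
  nonnull : ∀ t ∈ T, dot G (c t) (deriv c t) (deriv c t) ≠ 0

theorem vnorm_ne_zero {G : R2 → Matrix (Fin 2) (Fin 2) ℝ} {y u : R2} (h0 : dot G y u u ≠ 0) :
    vnorm G y u ≠ 0 :=
  Real.sqrt_ne_zero'.2 (abs_pos.2 h0)

/-- Together with `sign_mul_sign`, this makes the Euler–Poisson computation polynomial in `r =
1/‖u‖` and `σ`, with relations `(u · u) r² = σ` and `σ² = 1`. -/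
theorem dot_mul_inv_vnorm_sq {G : R2 → Matrix (Fin 2) (Fin 2) ℝ} {y u : R2}
    (h0 : dot G y u u ≠ 0) :
    dot G y u u * (vnorm G y u)⁻¹ ^ 2 = Real.sign (dot G y u u) := by
  have : vnorm G y u ^ 2 = |dot G y u u| := Real.sq_sqrt (abs_nonneg _)
  rw [inv_pow, this]
  rcases lt_or_gt_of_ne h0 with h | h
  · rw [Real.sign_of_neg h, abs_of_neg h]; field_simp
  · rw [Real.sign_of_pos h, abs_of_pos h]; field_simp

theorem sign_mul_sign {x : ℝ} (h : x ≠ 0) : Real.sign x * Real.sign x = 1 := by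
  rcases Real.sign_apply_eq_of_ne_zero x h with h | h <;> simp [h]

/-! ### Partial derivatives of the Lagrange function -/

namespace LocalMetric

variable {G : R2 → Matrix (Fin 2) (Fin 2) ℝ} {U : Set R2} (h : LocalMetric G U)
include h

/-- The derivative of `k - m ‖u‖` along a path of 2-jets. -/
theorem hasDerivAt_lagrangian (m : ℝ) {y u w : ℝ → R2} {y' u' w' : R2} {t : ℝ} (hyU : y t ∈ U)
    (hy : HasDerivAt y y' t) (hu : HasDerivAt u u' t) (hw : HasDerivAt w w' t)
    (h0 : dot G (y t) (u t) (u t) ≠ 0) :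
    HasDerivAt (fun s => lagrangian m G (y s) (u s) (w s))
      ((area G (y t) (u' + chr G (y t) y' (u t)) (covAcc G (y t) (u t) (w t))
          + area G (y t) (u t) (w' + (dchr G (y t) y' (u t) (u t) + chr G (y t) u' (u t)
            + chr G (y t) (u t) u') + chr G (y t) y' (covAcc G (y t) (u t) (w t))))
          * (vnorm G (y t) (u t))⁻¹ ^ 3
        - 3 * area G (y t) (u t) (covAcc G (y t) (u t) (w t))
          * Real.sign (dot G (y t) (u t) (u t)) * dot G (y t) (u t) (u' + chr G (y t) y' (u t))
          * (vnorm G (y t) (u t))⁻¹ ^ 5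
        - m * (Real.sign (dot G (y t) (u t) (u t)) * dot G (y t) (u t) (u' + chr G (y t) y' (u t))
          * (vnorm G (y t) (u t))⁻¹)) t := by
  have hN := vnorm_ne_zero h0
  have hacc := hw.add (h.hasDerivAt_chr hyU hy hu hu)
  have hA := h.hasDerivAt_area hyU hy hu hacc
  have hn := h.hasDerivAt_vnorm hyU hy hu h0
  have hL := (hA.div (hn.pow 3) (pow_ne_zero _ hN)).sub (hn.const_mul m)
  simp only [lagrangian, frenet, covAcc_eq]
  refine hL.congr_deriv ?_
  simp only [Pi.pow_apply, Pi.add_apply]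
  field_simp
  norm_num
  ring

section Partial

variable {y u w : R2} (hyU : y ∈ U) (h0 : dot G y u u ≠ 0) (m : ℝ) (i : Fin 2)
include hyU h0

theorem pd_lagrangian_pos : pd i (fun x => lagrangian m G x u w) y =
    (area G y (chr G y (std i) u) (covAcc G y u w)
      + area G y u (dchr G y (std i) u u + chr G y (std i) (covAcc G y u w)))
      * (vnorm G y u)⁻¹ ^ 3
    - 3 * area G y u (covAcc G y u w) * Real.sign (dot G y u u)
      * dot G y u (chr G y (std i) u) * (vnorm G y u)⁻¹ ^ 5
    - m * (Real.sign (dot G y u u) * dot G y u (chr G y (std i) u) * (vnorm G y u)⁻¹) := by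
  have hs : HasDerivAt (fun s : ℝ => y + s • std i) (std i) 0 := by
    simpa using ((hasDerivAt_id (0 : ℝ)).smul_const (std i)).const_add y
  refine pd_eq_of_hasDerivAt ((h.contDiffAt_lagrangian (y := fun x => x) hyU contDiffAt_id
    contDiffAt_const contDiffAt_const m h0).differentiableAt (by simp)) ?_
  have := h.hasDerivAt_lagrangian m (y := fun s => y + s • std i) (by simpa using hyU) hs
    (hasDerivAt_const 0 u) (hasDerivAt_const 0 w) (by simpa using h0)
  simpa [chr_zero_left, chr_zero_right] using this

theorem pd_lagrangian_vel : pd i (fun x => lagrangian m G y x w) u =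
    (area G y (std i) (covAcc G y u w) + 2 * area G y u (chr G y u (std i)))
      * (vnorm G y u)⁻¹ ^ 3
    - 3 * area G y u (covAcc G y u w) * Real.sign (dot G y u u)
      * dot G y u (std i) * (vnorm G y u)⁻¹ ^ 5
    - m * (Real.sign (dot G y u u) * dot G y u (std i) * (vnorm G y u)⁻¹) := by
  have hs : HasDerivAt (fun s : ℝ => u + s • std i) (std i) 0 := by
    simpa using ((hasDerivAt_id (0 : ℝ)).smul_const (std i)).const_add u
  refine pd_eq_of_hasDerivAt ((h.contDiffAt_lagrangian (a := fun x => x) hyU contDiffAt_const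
    contDiffAt_id contDiffAt_const m h0).differentiableAt (by simp)) ?_
  have := h.hasDerivAt_lagrangian m (y := fun _ => y) hyU (hasDerivAt_const 0 y) hs
    (hasDerivAt_const 0 w) (by simpa using h0)
  simpa [chr_zero_left, dchr_zero_left, h.chr_comm y (std i) u, area_add_right, two_mul]
    using this

theorem pd_lagrangian_acc : pd i (fun x => lagrangian m G y u x) w =
    area G y u (std i) * (vnorm G y u)⁻¹ ^ 3 := by
  have hs : HasDerivAt (fun s : ℝ => w + s • std i) (std i) 0 := by
    simpa using ((hasDerivAt_id (0 : ℝ)).smul_const (std i)).const_add w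
  refine pd_eq_of_hasDerivAt ((h.contDiffAt_lagrangian (b := fun x => x) hyU contDiffAt_const
    contDiffAt_const contDiffAt_id m h0).differentiableAt (by simp)) ?_
  have := h.hasDerivAt_lagrangian m (y := fun _ => y) hyU (hasDerivAt_const 0 y)
    (hasDerivAt_const 0 u) hs h0
  have z1 : ∀ v, area G y 0 v = 0 := fun v => by simp [area_expand]
  have z2 : dot G y u 0 = 0 := by simp [dot_expand]
  simpa [chr_zero_left, chr_zero_right, dchr_zero_left, z1, z2] using this

end Partial

end LocalMetric
theorem covAcc_eq_covD (G : R2 → Matrix (Fin 2) (Fin 2) ℝ) (c : ℝ → R2) (t : ℝ) :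
    covAcc G (c t) (deriv c t) (deriv (deriv c) t) = covD G c (deriv c) t := by
  rw [covAcc_eq, covD_eq]

/-- Nonvanishing continuous functions have locally constant sign, so `σ` may be treated as a
constant when differentiating. -/
theorem eventually_sign_eq {X : Type*} [TopologicalSpace X] {f : X → ℝ} {t : X}
    (hf : ContinuousAt f t) (h0 : f t ≠ 0) :
    ∀ᶠ s in nhds t, Real.sign (f s) = Real.sign (f t) := by
  rcases lt_or_gt_of_ne h0 with h | h
  · filter_upwards [hf.eventually_lt continuousAt_const h] with s hs
    rw [Real.sign_of_neg hs, Real.sign_of_neg h]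
  · filter_upwards [hf.eventually_const_lt h] with s hs
    rw [Real.sign_of_pos hs, Real.sign_of_pos h]

/-! ### Covariant calculus along a curve and the Euler–Poisson expression -/

namespace LocalCurve

variable {G : R2 → Matrix (Fin 2) (Fin 2) ℝ} {U : Set R2} {c : ℝ → R2} {T : Set ℝ}
  (hc : LocalCurve G U c T)
include hc

theorem contDiffAt {V : ℝ → R2} (hV : ContDiffOn ℝ ∞ V T) {t : ℝ} (ht : t ∈ T) :
    ContDiffAt ℝ ∞ V t :=
  hV.contDiffAt (hc.isOpen.mem_nhds ht)

theorem hasDerivAt_of_contDiffOn {V : ℝ → R2} (hV : ContDiffOn ℝ ∞ V T) {t : ℝ} (ht : t ∈ T) :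
    HasDerivAt V (deriv V t) t :=
  ((hc.contDiffAt hV ht).differentiableAt (by simp)).hasDerivAt

theorem contDiffOn_deriv {V : ℝ → R2} (hV : ContDiffOn ℝ ∞ V T) : ContDiffOn ℝ ∞ (deriv V) T :=
  hV.deriv_of_isOpen hc.isOpen (by simp)

theorem contDiffOn_covD (h : LocalMetric G U) {V : ℝ → R2} (hV : ContDiffOn ℝ ∞ V T) :
    ContDiffOn ℝ ∞ (covD G c V) T := by
  intro t ht
  have := (hc.contDiffAt (hc.contDiffOn_deriv hV) ht).add
    (h.contDiffAt_chr (hc.mapsTo t ht) (hc.contDiffAt hc.smooth ht)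
      (hc.contDiffAt (hc.contDiffOn_deriv hc.smooth) ht) (hc.contDiffAt hV ht))
  refine ContDiffAt.contDiffWithinAt ?_
  convert this using 1
  funext s; exact covD_eq G c V s

section

variable (h : LocalMetric G U) {V W : ℝ → R2} (hV : ContDiffOn ℝ ∞ V T) (hW : ContDiffOn ℝ ∞ W T)
  {t : ℝ} (ht : t ∈ T)
include h hV hW ht

theorem hasDerivAt_dot : HasDerivAt (fun s => dot G (c s) (V s) (W s))
    (dot G (c t) (covD G c V t) (W t) + dot G (c t) (V t) (covD G c W t)) t := by
  simp only [covD_eq]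
  exact h.hasDerivAt_dot (hc.mapsTo t ht) (hc.hasDerivAt_of_contDiffOn hc.smooth ht)
    (hc.hasDerivAt_of_contDiffOn hV ht) (hc.hasDerivAt_of_contDiffOn hW ht)

theorem hasDerivAt_area : HasDerivAt (fun s => area G (c s) (V s) (W s))
    (area G (c t) (covD G c V t) (W t) + area G (c t) (V t) (covD G c W t)) t := by
  simp only [covD_eq]
  exact h.hasDerivAt_area (hc.mapsTo t ht) (hc.hasDerivAt_of_contDiffOn hc.smooth ht)
    (hc.hasDerivAt_of_contDiffOn hV ht) (hc.hasDerivAt_of_contDiffOn hW ht)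

end

variable (h : LocalMetric G U) {t : ℝ} (ht : t ∈ T)
include h ht

theorem hasDerivAt_inv_vnorm : HasDerivAt (fun s => (vnorm G (c s) (deriv c s))⁻¹)
    (-(Real.sign (dot G (c t) (deriv c t) (deriv c t))
      * dot G (c t) (deriv c t) (covD G c (deriv c) t) * (vnorm G (c t) (deriv c t))⁻¹ ^ 3)) t := by
  have hN := vnorm_ne_zero (hc.nonnull t ht)
  refine ((h.hasDerivAt_vnorm (hc.mapsTo t ht) (hc.hasDerivAt_of_contDiffOn hc.smooth ht)
    (hc.hasDerivAt_of_contDiffOn (hc.contDiffOn_deriv hc.smooth) ht)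
    (hc.nonnull t ht)).inv hN).congr_deriv ?_
  rw [covD_eq]
  field_simp

theorem contDiffAt_momentum (v : R2) : ContDiffAt ℝ ∞
    (fun s => area G (c s) (deriv c s) v * (vnorm G (c s) (deriv c s))⁻¹ ^ 3) t := by
  have hu := hc.contDiffAt (hc.contDiffOn_deriv hc.smooth) ht
  have hy := hc.contDiffAt hc.smooth ht
  exact (h.contDiffAt_area (hc.mapsTo t ht) hy hu contDiffAt_const).mul
    (((h.contDiffAt_vnorm (hc.mapsTo t ht) hy hu (hc.nonnull t ht)).inv
      (vnorm_ne_zero (hc.nonnull t ht))).pow 3)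

theorem hasDerivAt_momentum (v : R2) : HasDerivAt
    (fun s => area G (c s) (deriv c s) v * (vnorm G (c s) (deriv c s))⁻¹ ^ 3)
    ((area G (c t) (covD G c (deriv c) t) v
        + area G (c t) (deriv c t) (chr G (c t) (deriv c t) v)) * (vnorm G (c t) (deriv c t))⁻¹ ^ 3
      - 3 * Real.sign (dot G (c t) (deriv c t) (deriv c t))
        * dot G (c t) (deriv c t) (covD G c (deriv c) t)
        * area G (c t) (deriv c t) v * (vnorm G (c t) (deriv c t))⁻¹ ^ 5) t := by
  refine ((hc.hasDerivAt_area h (hc.contDiffOn_deriv hc.smooth) (contDiffOn_const (c := v))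
    ht).mul ((hc.hasDerivAt_inv_vnorm h ht).pow 3)).congr_deriv ?_
  simp only [Pi.pow_apply]
  rw [covD_eq G c (fun _ => v), deriv_const, zero_add]
  push_cast
  ring

/-- The difference of `d/dt (∂L/∂w)` and `∂L/∂u`, evaluated on a vector `v`. -/
theorem hasDerivAt_momentum_sub (m : ℝ) (v : R2) : HasDerivAt
    (fun s => (-area G (c s) (covD G c (deriv c) s) v
        - area G (c s) (deriv c s) (chr G (c s) (deriv c s) v)) * (vnorm G (c s) (deriv c s))⁻¹ ^ 3
      + m * (Real.sign (dot G (c t) (deriv c t) (deriv c t)) * dot G (c s) (deriv c s) v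
        * (vnorm G (c s) (deriv c s))⁻¹))
    ((-area G (c t) (covD G c (covD G c (deriv c)) t) v
        - 2 * area G (c t) (covD G c (deriv c) t) (chr G (c t) (deriv c t) v)
        - area G (c t) (deriv c t) (dchr G (c t) (deriv c t) (deriv c t) v
          + chr G (c t) (deriv (deriv c) t) v + chr G (c t) (deriv c t) (chr G (c t) (deriv c t) v)))
        * (vnorm G (c t) (deriv c t))⁻¹ ^ 3
      + 3 * Real.sign (dot G (c t) (deriv c t) (deriv c t))
        * dot G (c t) (deriv c t) (covD G c (deriv c) t)
        * (area G (c t) (covD G c (deriv c) t) v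
          + area G (c t) (deriv c t) (chr G (c t) (deriv c t) v))
        * (vnorm G (c t) (deriv c t))⁻¹ ^ 5
      + m * (Real.sign (dot G (c t) (deriv c t) (deriv c t))
          * (dot G (c t) (covD G c (deriv c) t) v
            + dot G (c t) (deriv c t) (chr G (c t) (deriv c t) v)) * (vnorm G (c t) (deriv c t))⁻¹
        - dot G (c t) (deriv c t) v * dot G (c t) (deriv c t) (covD G c (deriv c) t)
          * (vnorm G (c t) (deriv c t))⁻¹ ^ 3)) t := by
  have hu := hc.contDiffOn_deriv hc.smooth
  have hX : HasDerivAt (fun s => chr G (c s) (deriv c s) v)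
      (dchr G (c t) (deriv c t) (deriv c t) v + chr G (c t) (deriv (deriv c) t) v
        + chr G (c t) (deriv c t) 0) t :=
    h.hasDerivAt_chr (hc.mapsTo t ht) (hc.hasDerivAt_of_contDiffOn hc.smooth ht)
      (hc.hasDerivAt_of_contDiffOn hu ht) (hasDerivAt_const t v)
  have h1 := hc.hasDerivAt_area h (hc.contDiffOn_covD h hu) (contDiffOn_const (c := v)) ht
  have h2 := h.hasDerivAt_area (hc.mapsTo t ht) (hc.hasDerivAt_of_contDiffOn hc.smooth ht)
    (hc.hasDerivAt_of_contDiffOn hu ht) hX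
  have h3 := hc.hasDerivAt_dot h hu (contDiffOn_const (c := v)) ht
  have hr := hc.hasDerivAt_inv_vnorm h ht
  refine (((h1.neg.sub h2).mul (hr.pow 3)).add
    (((h3.const_mul (Real.sign (dot G (c t) (deriv c t) (deriv c t)))).mul hr).const_mul
      m)).congr_deriv ?_
  simp only [Pi.pow_apply, Pi.neg_apply, Pi.sub_apply]
  rw [covD_eq G c (fun _ => v), deriv_const, zero_add, ← covD_eq G c (deriv c), chr_zero_right,
    add_zero]
  simp only [area_add_right]
  push_cast
  -- The frozen sign meets the sign produced by the derivative of `1/‖u‖`, and their product is `1`.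
  linear_combination (-m * dot G (c t) (deriv c t) v
    * dot G (c t) (deriv c t) (covD G c (deriv c) t)
    * (vnorm G (c t) (deriv c t))⁻¹ ^ 3) * sign_mul_sign (hc.nonnull t ht)

/-- The Euler-Poisson expression of `k - m ‖u‖`. -/
theorem eulerPoisson_eq (m : ℝ) (i : Fin 2) :
    eulerPoisson (lagrangian m G) c t i = eulerPoissonR m G c t i := by
  have hu := hc.contDiffOn_deriv hc.smooth
  have hT : ∀ᶠ s in nhds t, s ∈ T := hc.isOpen.mem_nhds ht
  have hdot := hc.hasDerivAt_dot h hu hu ht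
  -- `k` is affine in the acceleration, so `p = ∂L/∂w` is free of second derivatives.
  have hp : deriv (fun s => pd i (fun w => lagrangian m G (c s) (deriv c s) w)
      (deriv (deriv c) s)) =ᶠ[nhds t]
      deriv (fun s => area G (c s) (deriv c s) (std i) * (vnorm G (c s) (deriv c s))⁻¹ ^ 3) := by
    refine Filter.EventuallyEq.deriv ?_
    filter_upwards [hT] with s hs
    exact h.pd_lagrangian_acc (hc.mapsTo s hs) (hc.nonnull s hs) m i
  have hdp : DifferentiableAt ℝ (deriv fun s => pd i (fun w => lagrangian m G (c s) (deriv c s) w)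
      (deriv (deriv c) s)) t := by
    refine DifferentiableAt.congr_of_eventuallyEq ?_ hp
    have : ContDiffOn ℝ ∞ (fun s => area G (c s) (deriv c s) (std i)
        * (vnorm G (c s) (deriv c s))⁻¹ ^ 3) T := fun s hs =>
      (hc.contDiffAt_momentum h hs (std i)).contDiffWithinAt
    exact ((this.deriv_of_isOpen hc.isOpen (m := ∞) (by simp)).contDiffAt hT).differentiableAt
      (by simp)
  have hQ := hc.hasDerivAt_momentum_sub h ht m (std i)
  -- `∂L/∂u = ṗ - Q`, with the sign inside `Q` frozen at time `t`. The cyclic identity trades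
  -- `area(u, u') (u · e_i)` for terms that match `ṗ`. Since `ṗ` is differentiable by `hdp`, the two
  -- occurrences of `p̈` cancel in `E`.
  have hq : (fun s => pd i (fun u => lagrangian m G (c s) u (deriv (deriv c) s)) (deriv c s))
      =ᶠ[nhds t] (deriv fun s => pd i (fun w => lagrangian m G (c s) (deriv c s) w)
        (deriv (deriv c) s)) - fun s => (-area G (c s) (covD G c (deriv c) s) (std i)
        - area G (c s) (deriv c s) (chr G (c s) (deriv c s) (std i)))
          * (vnorm G (c s) (deriv c s))⁻¹ ^ 3
      + m * (Real.sign (dot G (c t) (deriv c t) (deriv c t)) * dot G (c s) (deriv c s) (std i)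
        * (vnorm G (c s) (deriv c s))⁻¹) := by
    filter_upwards [hT, hp, eventually_sign_eq hdot.continuousAt (hc.nonnull t ht)]
      with s hs hps hsign
    rw [Pi.sub_apply, hps, (hc.hasDerivAt_momentum h hs (std i)).deriv,
      h.pd_lagrangian_vel (hc.mapsTo s hs) (hc.nonnull s hs), covAcc_eq_covD, ← hsign,
      area_swap G (c s) (std i)]
    have hD := dot_mul_inv_vnorm_sq (hc.nonnull s hs)
    have hσ := sign_mul_sign (hc.nonnull s hs)
    have hcyc := area_mul_dot G (c s) (deriv c s) (covD G c (deriv c) s) (std i)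
    generalize (vnorm G (c s) (deriv c s))⁻¹ = r at *
    generalize Real.sign (dot G (c s) (deriv c s) (deriv c s)) = σ at *
    linear_combination (-3 * σ * r ^ 5) * hcyc
      + 3 * σ * r ^ 3 * area G (c s) (covD G c (deriv c) s) (std i) * hD
      + 3 * r ^ 3 * area G (c s) (covD G c (deriv c) s) (std i) * hσ
  have hdq := hq.deriv_eq.trans (hdp.hasDerivAt.sub hQ).deriv
  rw [eulerPoisson, hdq, h.pd_lagrangian_pos (hc.mapsTo t ht) (hc.nonnull t ht),
    covAcc_eq_covD, eulerPoissonR_eq, forceForm, curv]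
  have hD := dot_mul_inv_vnorm_sq (hc.nonnull t ht)
  have hσ := sign_mul_sign (hc.nonnull t ht)
  -- The cyclic identity, now with `Γ(u, e_i)` as third vector, removes the non-tensorial terms that
  -- carry `u'`.
  have hcyc := area_mul_dot G (c t) (deriv c t) (covD G c (deriv c) t)
    (chr G (c t) (deriv c t) (std i))
  -- Splitting `u'` into `ẍ + Γ(u, u)` cancels the terms in `ẍ`; the remaining `∂Γ` and `ΓΓ` terms
  -- are exactly those of `curv`.
  have hu1 : chr G (c t) (std i) (covD G c (deriv c) t) =
      chr G (c t) (deriv (deriv c) t) (std i)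
        + chr G (c t) (std i) (chr G (c t) (deriv c t) (deriv c t)) := by
    rw [covD_eq, chr_add_right, h.chr_comm (c t) (std i)]
  rw [h.chr_comm (c t) (std i) (deriv c t), hu1, h.dchr_comm (c t) (deriv c t) (std i),
    area_swap G (c t) (chr G (c t) (deriv c t) (std i)), h.dot_comm (c t) (covD G c (deriv c) t)
      (deriv c t)]
  simp only [sub_eq_add_neg, area_add_right, div_eq_mul_inv, ← inv_pow]
  have hneg : ∀ a b, area G (c t) a (-b) = -area G (c t) a b := fun a b => by
    simp only [area_expand, PiLp.neg_apply]; ring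
  simp only [hneg]
  generalize (vnorm G (c t) (deriv c t))⁻¹ = r at *
  generalize Real.sign (dot G (c t) (deriv c t) (deriv c t)) = σ at *
  linear_combination (-3 * σ * r ^ 5) * hcyc
      + 3 * σ * r ^ 3
        * area G (c t) (covD G c (deriv c) t) (chr G (c t) (deriv c t) (std i)) * hD
      + 3 * r ^ 3
        * area G (c t) (covD G c (deriv c) t) (chr G (c t) (deriv c t) (std i)) * hσ
      - m * r * dot G (c t) (covD G c (deriv c) t) (std i) * hD

end LocalCurve
/-! ### Linearity of the force and conservation of the curvature -/

/-- The expression `E^R` along a curve, evaluated on a vector `v`. -/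
noncomputable abbrev curveForce (m : ℝ) (G : R2 → Matrix (Fin 2) (Fin 2) ℝ) (c : ℝ → R2) (t : ℝ)
    (v : R2) : ℝ :=
  forceForm m G (c t) (deriv c t) (covD G c (deriv c) t) (covD G c (covD G c (deriv c)) t) v

section

variable (m : ℝ) (G : R2 → Matrix (Fin 2) (Fin 2) ℝ) (y u u₁ u₂ : R2)

theorem forceForm_add (v w : R2) :
    forceForm m G y u u₁ u₂ (v + w) = forceForm m G y u u₁ u₂ v + forceForm m G y u u₁ u₂ w := by
  simp only [forceForm, curv, area_expand, dot_expand, chr_apply, dchr_expand, Fin.sum_univ_two,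
    PiLp.add_apply, PiLp.sub_apply]
  ring

theorem forceForm_smul (r : ℝ) (v : R2) :
    forceForm m G y u u₁ u₂ (r • v) = r * forceForm m G y u u₁ u₂ v := by
  simp only [forceForm, curv, area_expand, dot_expand, chr_apply, dchr_expand, Fin.sum_univ_two,
    PiLp.add_apply, PiLp.sub_apply, PiLp.smul_apply, smul_eq_mul]
  ring

/-- The force is affine in `u''`, and a change of `u''` along `u` is seen only by vectors
transversal to `u`. This is how `θ'''` acts on it. -/
theorem forceForm_add_smul (z : ℝ) (v : R2) :
    forceForm m G y u u₁ (z • u + u₂) v =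
      forceForm m G y u u₁ u₂ v - z * area G y u v / vnorm G y u ^ 3 := by
  simp only [forceForm, area_add_left, area_smul_left]
  ring

theorem curv_self (a v : R2) : curv G y a a v = 0 := by simp [curv]

variable {m G y u u₁ u₂}

/-- A linear form on the plane is decided by two independent vectors. The pair is the coordinate
basis for extremals, and the velocity with its rotation for reparametrized circles. -/
theorem forceForm_eq_zero {n a : R2} (hna : n 0 * a 1 - n 1 * a 0 ≠ 0)
    (hn : forceForm m G y u u₁ u₂ n = 0) (ha : forceForm m G y u u₁ u₂ a = 0) (v : R2) :
    forceForm m G y u u₁ u₂ v = 0 := by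
  -- Cramer's rule for `v` in the basis `n`, `a`.
  have hv : (n 0 * a 1 - n 1 * a 0) • v =
      (v 0 * a 1 - v 1 * a 0) • n + (n 0 * v 1 - n 1 * v 0) • a := by
    ext i; fin_cases i <;> simp <;> ring
  have := congrArg (forceForm m G y u u₁ u₂) hv
  rw [forceForm_add, forceForm_smul, forceForm_smul, forceForm_smul, hn, ha] at this
  simpa [hna] using this

end

/-- The signed Frenet curvature along a curve in the plane. -/
noncomputable abbrev curveCurvature (G : R2 → Matrix (Fin 2) (Fin 2) ℝ) (c : ℝ → R2) (t : ℝ) : ℝ :=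
  frenet G (c t) (deriv c t) (deriv (deriv c) t)

theorem curveCurvature_eq (G : R2 → Matrix (Fin 2) (Fin 2) ℝ) (c : ℝ → R2) (t : ℝ) :
    curveCurvature G c t =
      area G (c t) (deriv c t) (covD G c (deriv c) t) * (vnorm G (c t) (deriv c t))⁻¹ ^ 3 := by
  rw [curveCurvature, frenet, covAcc_eq_covD, div_eq_mul_inv, inv_pow]

/-- On `v = u` the `m`-term cancels and `curv G y u u u = 0`, so `m` drops out. The other two terms
are the product rule for `area(u, u') ‖u‖⁻³`, because `area(u', u') = 0`. -/
theorem LocalCurve.hasDerivAt_curveCurvature {G : R2 → Matrix (Fin 2) (Fin 2) ℝ} {U : Set R2}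
    {c : ℝ → R2} {T : Set ℝ} (hc : LocalCurve G U c T) (h : LocalMetric G U) {t : ℝ} (ht : t ∈ T)
    (m : ℝ) : HasDerivAt (curveCurvature G c) (curveForce m G c t (deriv c t)) t := by
  have hu := hc.contDiffOn_deriv hc.smooth
  have hk : curveCurvature G c = fun t => area G (c t) (deriv c t) (covD G c (deriv c) t)
      * (vnorm G (c t) (deriv c t))⁻¹ ^ 3 := funext (curveCurvature_eq G c)
  rw [hk]
  refine ((hc.hasDerivAt_area h hu (hc.contDiffOn_covD h hu) ht).mul
    ((hc.hasDerivAt_inv_vnorm h ht).pow 3)).congr_deriv ?_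
  have h0 : area G (c t) (deriv c t) 0 = 0 := by simp [area_expand]
  simp only [curveForce, forceForm, Pi.pow_apply, curv_self, h0, area_self]
  rw [area_swap G (c t) (covD G c (covD G c (deriv c)) t),
    area_swap G (c t) (covD G c (deriv c) t), h.dot_comm (c t) (covD G c (deriv c) t)]
  simp only [div_eq_mul_inv, ← inv_pow]
  push_cast
  ring

/-! ### Reparametrization -/

/-- `θ` is a smooth orientation-preserving change of parameter from `J` into `T`. -/
structure LocalReparam (θ : ℝ → ℝ) (J T : Set ℝ) : Prop where
  isOpen : IsOpen J
  smooth : ContDiffOn ℝ ∞ θ J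
  deriv_pos : ∀ s ∈ J, 0 < deriv θ s
  mapsTo : Set.MapsTo θ J T

theorem differentiableAt_of_isOpen {E : Type*} [NormedAddCommGroup E] [NormedSpace ℝ E]
    {f : ℝ → E} {S : Set ℝ} {r : ℝ} (hS : IsOpen S) (hf : ContDiffOn ℝ ∞ f S) (hr : r ∈ S) :
    DifferentiableAt ℝ f r :=
  (hf.contDiffAt (hS.mem_nhds hr)).differentiableAt (by simp)

theorem covD_congr {G : R2 → Matrix (Fin 2) (Fin 2) ℝ} {c V W : ℝ → R2} {t : ℝ}
    (hVW : V =ᶠ[nhds t] W) : covD G c V t = covD G c W t := by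
  rw [covD_eq, covD_eq, hVW.deriv_eq, hVW.eq_of_nhds]

theorem covD_add {G : R2 → Matrix (Fin 2) (Fin 2) ℝ} {c V W : ℝ → R2} {t : ℝ}
    (hV : DifferentiableAt ℝ V t) (hW : DifferentiableAt ℝ W t) :
    covD G c (V + W) t = covD G c V t + covD G c W t := by
  rw [covD_eq, covD_eq, covD_eq, deriv_add hV hW, Pi.add_apply, chr_add_right]
  abel

/-- Leibniz and chain rule in one; the free factor `f` allows iteration, with `f` equal to `θ'`,
`θ''` and `θ'²`. -/
theorem covD_smul_comp {G : R2 → Matrix (Fin 2) (Fin 2) ℝ} {c V : ℝ → R2} {f θ : ℝ → ℝ} {s : ℝ}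
    (hc : DifferentiableAt ℝ c (θ s)) (hV : DifferentiableAt ℝ V (θ s))
    (hf : DifferentiableAt ℝ f s) (hθ : DifferentiableAt ℝ θ s) :
    covD G (c ∘ θ) (fun r => f r • V (θ r)) s =
      deriv f s • V (θ s) + (f s * deriv θ s) • covD G c V (θ s) := by
  have h1 : deriv (c ∘ θ) s = deriv θ s • deriv c (θ s) :=
    (hc.hasDerivAt.scomp s hθ.hasDerivAt).deriv
  have h2 : deriv (fun r => f r • V (θ r)) s =
      f s • deriv θ s • deriv V (θ s) + deriv f s • V (θ s) :=
    (hf.hasDerivAt.smul (hV.hasDerivAt.scomp s hθ.hasDerivAt)).deriv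
  rw [covD_eq, covD_eq, h1, h2]
  simp only [Function.comp_apply, chr_smul_left, chr_smul_right, smul_add, mul_smul]
  abel

namespace LocalCurve

variable {G : R2 → Matrix (Fin 2) (Fin 2) ℝ} {U : Set R2} {c : ℝ → R2} {T : Set ℝ}
  (hc : LocalCurve G U c T) {θ : ℝ → ℝ} {J : Set ℝ} (hθ : LocalReparam θ J T)
include hc hθ

theorem deriv_comp {s : ℝ} (hs : s ∈ J) :
    deriv (c ∘ θ) s = deriv θ s • deriv c (θ s) :=
  ((hc.hasDerivAt_of_contDiffOn hc.smooth (hθ.mapsTo hs)).scomp s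
    ((hθ.smooth.contDiffAt (hθ.isOpen.mem_nhds hs)).differentiableAt
      (by simp)).hasDerivAt).deriv

theorem comp : LocalCurve G U (c ∘ θ) J where
  isOpen := hθ.isOpen
  smooth := hc.smooth.comp hθ.smooth hθ.mapsTo
  mapsTo s hs := hc.mapsTo _ (hθ.mapsTo hs)
  nonnull s hs := by
    rw [hc.deriv_comp hθ hs, dot_smul_left, dot_smul_right]
    have := (hθ.deriv_pos s hs).ne'
    exact mul_ne_zero this (mul_ne_zero this (hc.nonnull _ (hθ.mapsTo hs)))

variable {s : ℝ} (hs : s ∈ J)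
include hs

theorem covD_deriv_comp : covD G (c ∘ θ) (deriv (c ∘ θ)) s =
    deriv (deriv θ) s • deriv c (θ s) + (deriv θ s) ^ 2 • covD G c (deriv c) (θ s) := by
  have hev : deriv (c ∘ θ) =ᶠ[nhds s] fun r => deriv θ r • deriv c (θ r) := by
    filter_upwards [hθ.isOpen.mem_nhds hs] with r hr using hc.deriv_comp hθ hr
  rw [covD_congr hev, covD_smul_comp (differentiableAt_of_isOpen hc.isOpen hc.smooth (hθ.mapsTo hs))
    (differentiableAt_of_isOpen hc.isOpen (hc.contDiffOn_deriv hc.smooth) (hθ.mapsTo hs))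
    (differentiableAt_of_isOpen hθ.isOpen (hθ.smooth.deriv_of_isOpen hθ.isOpen (m := ∞) (by simp)) hs)
    (differentiableAt_of_isOpen hθ.isOpen hθ.smooth hs), sq]

/-- The signed Frenet curvature does not depend on the parametrization. -/
theorem curveCurvature_comp : curveCurvature G (c ∘ θ) s = curveCurvature G c (θ s) := by
  have hp := hθ.deriv_pos s hs
  have hn : vnorm G (c (θ s)) (deriv θ s • deriv c (θ s)) =
      deriv θ s * vnorm G (c (θ s)) (deriv c (θ s)) := by
    rw [vnorm, dot_smul_left, dot_smul_right, ← mul_assoc, abs_mul, Real.sqrt_mul (abs_nonneg _),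
      abs_mul_self, Real.sqrt_mul_self hp.le, vnorm]
  rw [curveCurvature_eq, curveCurvature_eq, hc.covD_deriv_comp hθ hs, hc.deriv_comp hθ hs,
    Function.comp_apply, hn]
  simp only [area_add_right, area_smul_left, area_smul_right, area_self]
  field_simp
  ring

variable (h : LocalMetric G U)
include h

/-- The point is that `θ'''` multiplies the velocity alone, so the extremal equation can be solved
for it. -/
theorem covD_covD_deriv_comp : covD G (c ∘ θ) (covD G (c ∘ θ) (deriv (c ∘ θ))) s =
    deriv (deriv (deriv θ)) s • deriv c (θ s)
      + ((3 * deriv θ s * deriv (deriv θ) s) • covD G c (deriv c) (θ s)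
      + (deriv θ s) ^ 3 • covD G c (covD G c (deriv c)) (θ s)) := by
  have hev : covD G (c ∘ θ) (deriv (c ∘ θ)) =ᶠ[nhds s]
      (fun r => deriv (deriv θ) r • deriv c (θ r))
        + fun r => (deriv θ r) ^ 2 • covD G c (deriv c) (θ r) := by
    filter_upwards [hθ.isOpen.mem_nhds hs] with r hr using hc.covD_deriv_comp hθ hr
  have hu := hc.contDiffOn_deriv hc.smooth
  have hθ1 := hθ.smooth.deriv_of_isOpen hθ.isOpen (m := ∞) (by simp)
  have d0 := differentiableAt_of_isOpen hθ.isOpen hθ.smooth hs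
  have d1 := differentiableAt_of_isOpen hθ.isOpen hθ1 hs
  have d2 := differentiableAt_of_isOpen hθ.isOpen (hθ1.deriv_of_isOpen hθ.isOpen (m := ∞) (by simp)) hs
  have e0 := differentiableAt_of_isOpen hc.isOpen hc.smooth (hθ.mapsTo hs)
  have e1 := differentiableAt_of_isOpen hc.isOpen hu (hθ.mapsTo hs)
  have e2 := differentiableAt_of_isOpen hc.isOpen (hc.contDiffOn_covD h hu) (hθ.mapsTo hs)
  have d1sq : deriv (fun r => deriv θ r ^ 2) s = 2 * deriv θ s * deriv (deriv θ) s := by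
    refine (d1.hasDerivAt.pow 2).deriv.trans ?_
    push_cast
    ring
  rw [covD_congr hev, covD_add (V := fun r => deriv (deriv θ) r • deriv c (θ r))
      (W := fun r => deriv θ r ^ 2 • covD G c (deriv c) (θ r)) (d2.smul (e1.comp s d0))
      ((d1.pow 2).smul (e2.comp s d0)),
    covD_smul_comp e0 e1 d2 d0, covD_smul_comp (f := fun r => deriv θ r ^ 2) e0 e2 (d1.pow 2) d0,
    d1sq]
  module

end LocalCurve
/-! ### Parametrizations that turn geodesic circles into extremals -/

section

variable {E : Type*} [NormedAddCommGroup E] [NormedSpace ℝ E] {x : E}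

namespace LocalMetric

variable {G : R2 → Matrix (Fin 2) (Fin 2) ℝ} {U : Set R2} (h : LocalMetric G U)
include h
variable {y a b e : E → R2} (hyU : y x ∈ U) (hy : ContDiffAt ℝ ∞ y x)
include hyU hy

theorem contDiffAt_dchr (ha : ContDiffAt ℝ ∞ a x) (hb : ContDiffAt ℝ ∞ b x)
    (he : ContDiffAt ℝ ∞ e x) : ContDiffAt ℝ ∞ (fun z => dchr G (y z) (e z) (a z) (b z)) x := by
  refine contDiffAt_euclidean.2 fun i => ?_
  simp only [dchr_expand]
  refine ContDiffAt.sum fun k _ => ContDiffAt.sum fun j _ => ContDiffAt.sum fun l _ => ?_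
  have := (ContDiffOn.pd h.isOpen (h.contDiffOn_christoffel i j l) k).contDiffAt
    (h.isOpen.mem_nhds hyU)
  exact (((this.comp x hy).mul (he.coord k)).mul (ha.coord j)).mul (hb.coord l)

theorem contDiffAt_curv (ha : ContDiffAt ℝ ∞ a x) (hb : ContDiffAt ℝ ∞ b x)
    (he : ContDiffAt ℝ ∞ e x) : ContDiffAt ℝ ∞ (fun z => curv G (y z) (a z) (b z) (e z)) x :=
  (((h.contDiffAt_dchr hyU hy ha he hb).sub (h.contDiffAt_dchr hyU hy hb he ha)).add
    (h.contDiffAt_chr hyU hy hb (h.contDiffAt_chr hyU hy ha he))).sub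
    (h.contDiffAt_chr hyU hy ha (h.contDiffAt_chr hyU hy hb he))

theorem contDiffAt_forceForm (m : ℝ) {u u₁ u₂ v : E → R2} (hu : ContDiffAt ℝ ∞ u x)
    (hu₁ : ContDiffAt ℝ ∞ u₁ x) (hu₂ : ContDiffAt ℝ ∞ u₂ x) (hv : ContDiffAt ℝ ∞ v x)
    (h0 : dot G (y x) (u x) (u x) ≠ 0) :
    ContDiffAt ℝ ∞ (fun z => forceForm m G (y z) (u z) (u₁ z) (u₂ z) (v z)) x := by
  have hN := h.contDiffAt_vnorm hyU hy hu h0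
  have hN0 := vnorm_ne_zero h0
  have huu := h.contDiffAt_dot hyU hy hu hu
  have hs : ContDiffAt ℝ ∞ (fun z => Real.sign (dot G (y z) (u z) (u z))) x :=
    contDiffAt_const.congr_of_eventuallyEq (eventually_sign_eq huu.continuousAt h0)
  refine ((ContDiffAt.add (ContDiffAt.div ?_ (hN.pow 3) (pow_ne_zero _ hN0))
    ((ContDiffAt.div ?_ (hN.pow 5) (pow_ne_zero _ hN0)).mul ?_)).add
    (contDiffAt_const.mul (ContDiffAt.div ?_ (hN.pow 3) (pow_ne_zero _ hN0)))).sub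
    (ContDiffAt.div ?_ (hN.pow 3) (pow_ne_zero _ hN0))
  · exact (h.contDiffAt_area hyU hy hu₂ hv).neg
  · exact (contDiffAt_const.mul hs).mul (h.contDiffAt_dot hyU hy hu hu₁)
  · exact h.contDiffAt_area hyU hy hu₁ hv
  · exact (huu.mul (h.contDiffAt_dot hyU hy hu₁ hv)).sub
      ((h.contDiffAt_dot hyU hy hu₁ hu).mul (h.contDiffAt_dot hyU hy hu hv))
  · exact h.contDiffAt_area hyU hy hu (h.contDiffAt_curv hyU hy hv hu hu)

end LocalMetric

end

/-- Local smooth solutions of autonomous ordinary differential equations, staying in a given open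
set. -/
theorem exists_smooth_integralCurve {E : Type*} [NormedAddCommGroup E] [NormedSpace ℝ E]
    [CompleteSpace E] {F : E → E} {W : Set E} (hW : IsOpen W) (hF : ContDiffOn ℝ ∞ F W) {x₀ : E}
    (hx₀ : x₀ ∈ W) (t₀ : ℝ) : ∃ α : ℝ → E, α t₀ = x₀ ∧ ∃ ε > (0 : ℝ),
      ContDiffOn ℝ ∞ α (Set.Ioo (t₀ - ε) (t₀ + ε)) ∧
      ∀ t ∈ Set.Ioo (t₀ - ε) (t₀ + ε), α t ∈ W ∧ HasDerivAt α (F (α t)) t := by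
  obtain ⟨α, hα₀, ε, hε, hα⟩ := ((hF.contDiffAt (hW.mem_nhds hx₀)).of_le
    (by simp)).exists_forall_mem_closedBall_exists_eq_forall_mem_Ioo_hasDerivAt₀ t₀
  have hcont : ContinuousAt α t₀ := (hα t₀ ⟨by linarith, by linarith⟩).continuousAt
  have hmem : ∀ᶠ t in nhds t₀, α t ∈ W := hcont.eventually (hW.mem_nhds (hα₀ ▸ hx₀))
  obtain ⟨δ, hδ, hball⟩ := Metric.eventually_nhds_iff.1 hmem
  -- Halving keeps the closed interval inside both neighbourhoods; the regularity theorem for ODE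
  -- solutions used below works on closed intervals.
  set r := min ε δ / 2 with hr
  have hr0 : 0 < r := by positivity
  have hrε : r < ε := by
    have := min_le_left ε δ
    linarith
  have hrδ : r < δ := by
    have := min_le_right ε δ
    linarith
  have hmap : ∀ t ∈ Set.Icc (t₀ - r) (t₀ + r), α t ∈ W := fun t ht => hball (by
    rw [Real.dist_eq, abs_lt]; constructor <;> linarith [ht.1, ht.2])
  have hder : ∀ t ∈ Set.Icc (t₀ - r) (t₀ + r), HasDerivAt α (F (α t)) t := fun t ht =>
    hα t ⟨by linarith [ht.1], by linarith [ht.2]⟩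
  refine ⟨α, hα₀, r, hr0, ?_, fun t ht => ⟨hmap t (Set.Ioo_subset_Icc_self ht),
    hder t (Set.Ioo_subset_Icc_self ht)⟩⟩
  refine ContDiffOn.mono ?_ Set.Ioo_subset_Icc_self
  refine ODE.contDiffOn_enat_Icc_of_hasDerivWithinAt (f := fun _ => F) (n := ⊤) (u := W) ?_
    (fun t ht => (hder t ht).hasDerivWithinAt) hmap
  exact hF.comp contDiffOn_snd fun p hp => hp.2

/-- The vector `u` rotated by a right angle in the coordinate plane. -/
noncomputable def rot (u : R2) : R2 := !₂[-u 1, u 0]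

theorem sq_add_sq_pos {u : R2} (hu : u ≠ 0) : 0 < u 0 ^ 2 + u 1 ^ 2 := by
  by_contra hle
  apply hu
  ext i
  fin_cases i
  · simp; nlinarith [sq_nonneg (u 0), sq_nonneg (u 1)]
  · simp; nlinarith [sq_nonneg (u 0), sq_nonneg (u 1)]

/-- For `u ≠ 0` this is positive in every signature, so `rot u` is a transversal direction. -/
theorem area_rot (G : R2 → Matrix (Fin 2) (Fin 2) ℝ) (y u : R2) :
    area G y u (rot u) = density G y * (u 0 ^ 2 + u 1 ^ 2) := by
  simp [area_expand, rot]; ring_nf; simp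

theorem LocalMetric.density_pos {G : R2 → Matrix (Fin 2) (Fin 2) ℝ} {U : Set R2}
    (h : LocalMetric G U) {y : R2} (hy : y ∈ U) : 0 < density G y :=
  Real.sqrt_pos.2 (abs_pos.2 (h.det_ne y hy))

theorem ne_zero_of_dot_ne_zero {G : R2 → Matrix (Fin 2) (Fin 2) ℝ} {y u : R2}
    (h0 : dot G y u u ≠ 0) : u ≠ 0 := by
  rintro rfl
  simp [dot_expand] at h0

namespace LocalCurve

variable {G : R2 → Matrix (Fin 2) (Fin 2) ℝ} {U : Set R2} {c : ℝ → R2} {T : Set ℝ}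
  (hc : LocalCurve G U c T) (h : LocalMetric G U)
include hc h

/-- A curve of constant curvature is locally an extremal in a suitable parametrization. -/
theorem exists_reparam (m : ℝ) {κ : ℝ} (hκ : ∀ t ∈ T, curveCurvature G c t = κ) {t₀ : ℝ}
    (ht₀ : t₀ ∈ T) : ∃ (ε : ℝ) (θ : ℝ → ℝ), 0 < ε ∧ θ t₀ = t₀ ∧
      LocalReparam θ (Set.Ioo (t₀ - ε) (t₀ + ε)) T ∧
      ∀ s ∈ Set.Ioo (t₀ - ε) (t₀ + ε), ∀ v, curveForce m G (c ∘ θ) s v = 0 := by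
  have hu := hc.contDiffOn_deriv hc.smooth
  have hu₁ := hc.contDiffOn_covD h hu
  have hu₂ := hc.contDiffOn_covD h hu₁
  -- With `x = (θ, θ', θ'')`, this is the value of `θ'''` for which the force of `c ∘ θ` vanishes on
  -- `rot u`, by `forceForm_add_smul`.
  set H : ℝ × ℝ × ℝ → ℝ := fun x =>
    forceForm m G (c x.1) (x.2.1 • deriv c x.1)
      (x.2.2 • deriv c x.1 + x.2.1 ^ 2 • covD G c (deriv c) x.1)
      ((3 * x.2.1 * x.2.2) • covD G c (deriv c) x.1
        + x.2.1 ^ 3 • covD G c (covD G c (deriv c)) x.1) (rot (deriv c x.1))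
    * vnorm G (c x.1) (x.2.1 • deriv c x.1) ^ 3 / area G (c x.1) (deriv c x.1) (rot (deriv c x.1))
    with hH
  set W : Set (ℝ × ℝ × ℝ) := {x | x.1 ∈ T ∧ 0 < x.2.1} with hW
  have hWo : IsOpen W := (hc.isOpen.preimage continuous_fst).inter
    (isOpen_lt continuous_const (continuous_fst.comp continuous_snd))
  have harea : ∀ t ∈ T, area G (c t) (deriv c t) (rot (deriv c t)) ≠ 0 := fun t ht => by
    rw [area_rot]
    exact (mul_pos (h.density_pos (hc.mapsTo t ht))
      (sq_add_sq_pos (ne_zero_of_dot_ne_zero (hc.nonnull t ht)))).ne'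
  have hHs : ContDiffOn ℝ ∞ H W := by
    rintro x ⟨hx, hp⟩
    refine ContDiffAt.contDiffWithinAt ?_
    have hfst : ContDiffAt ℝ ∞ (fun z : ℝ × ℝ × ℝ => z.1) x := contDiffAt_fst
    have hp1 : ContDiffAt ℝ ∞ (fun z : ℝ × ℝ × ℝ => z.2.1) x :=
      contDiff_fst.comp contDiff_snd |>.contDiffAt
    have hp2 : ContDiffAt ℝ ∞ (fun z : ℝ × ℝ × ℝ => z.2.2) x :=
      contDiff_snd.comp contDiff_snd |>.contDiffAt
    have cy : ContDiffAt ℝ ∞ (fun z : ℝ × ℝ × ℝ => c z.1) x :=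
      (hc.contDiffAt hc.smooth hx).comp x hfst
    have cu : ContDiffAt ℝ ∞ (fun z : ℝ × ℝ × ℝ => deriv c z.1) x :=
      (hc.contDiffAt hu hx).comp x hfst
    have cu₁ : ContDiffAt ℝ ∞ (fun z : ℝ × ℝ × ℝ => covD G c (deriv c) z.1) x :=
      (hc.contDiffAt hu₁ hx).comp x hfst
    have cu₂ : ContDiffAt ℝ ∞ (fun z : ℝ × ℝ × ℝ => covD G c (covD G c (deriv c)) z.1) x :=
      (hc.contDiffAt hu₂ hx).comp x hfst
    have crot : ContDiffAt ℝ ∞ (fun z : ℝ × ℝ × ℝ => rot (deriv c z.1)) x := by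
      refine contDiffAt_euclidean.2 fun i => ?_
      fin_cases i
      · simpa [rot] using (cu.coord 1).neg
      · simpa [rot] using cu.coord 0
    have hU := hc.mapsTo _ hx
    have h0 : dot G (c x.1) (x.2.1 • deriv c x.1) (x.2.1 • deriv c x.1) ≠ 0 := by
      rw [dot_smul_left, dot_smul_right]
      exact mul_ne_zero hp.ne' (mul_ne_zero hp.ne' (hc.nonnull _ hx))
    have cpu := hp1.smul cu
    refine ((h.contDiffAt_forceForm (y := fun z : ℝ × ℝ × ℝ => c z.1) hU cy m cpu ?_ ?_ crot
      h0).mul ((h.contDiffAt_vnorm (y := fun z : ℝ × ℝ × ℝ => c z.1) hU cy cpu h0).pow 3)).div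
      (h.contDiffAt_area (y := fun z : ℝ × ℝ × ℝ => c z.1) hU cy cu crot) (harea _ hx)
    · exact (hp2.smul cu).add ((hp1.pow 2).smul cu₁)
    · exact (((contDiffAt_const.mul hp1).mul hp2).smul cu₁).add ((hp1.pow 3).smul cu₂)
  have hFs : ContDiffOn ℝ ∞ (fun x : ℝ × ℝ × ℝ => (x.2.1, x.2.2, H x)) W :=
    (contDiff_fst.comp contDiff_snd).contDiffOn.prodMk
      ((contDiff_snd.comp contDiff_snd).contDiffOn.prodMk hHs)
  -- Initial data `θ = t₀`, `θ' = 1`, `θ'' = 0`; only `θ = t₀` and `θ' > 0` matter.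
  obtain ⟨α, hα₀, ε, hε, hαs, hα⟩ := exists_smooth_integralCurve hWo hFs
    (x₀ := (t₀, 1, 0)) ⟨ht₀, one_pos⟩ t₀
  have hJ : IsOpen (Set.Ioo (t₀ - ε) (t₀ + ε)) := isOpen_Ioo
  set θ : ℝ → ℝ := fun s => (α s).1 with hθ
  have h1 : ∀ s ∈ Set.Ioo (t₀ - ε) (t₀ + ε), deriv θ s = (α s).2.1 := fun s hs =>
    ((ContinuousLinearMap.fst ℝ ℝ (ℝ × ℝ)).hasFDerivAt.comp_hasDerivAt s (hα s hs).2).deriv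
  have h2 : ∀ s ∈ Set.Ioo (t₀ - ε) (t₀ + ε), deriv (deriv θ) s = (α s).2.2 := fun s hs => by
    have : deriv θ =ᶠ[nhds s] fun s => (α s).2.1 :=
      Filter.eventually_of_mem (hJ.mem_nhds hs) h1
    rw [this.deriv_eq]
    exact ((ContinuousLinearMap.fst ℝ ℝ ℝ ∘L
      ContinuousLinearMap.snd ℝ ℝ (ℝ × ℝ)).hasFDerivAt.comp_hasDerivAt s (hα s hs).2).deriv
  have h3 : ∀ s ∈ Set.Ioo (t₀ - ε) (t₀ + ε), deriv (deriv (deriv θ)) s = H (α s) := fun s hs => by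
    have : deriv (deriv θ) =ᶠ[nhds s] fun s => (α s).2.2 :=
      Filter.eventually_of_mem (hJ.mem_nhds hs) h2
    rw [this.deriv_eq]
    exact ((ContinuousLinearMap.snd ℝ ℝ ℝ ∘L
      ContinuousLinearMap.snd ℝ ℝ (ℝ × ℝ)).hasFDerivAt.comp_hasDerivAt s (hα s hs).2).deriv
  have hrep : LocalReparam θ (Set.Ioo (t₀ - ε) (t₀ + ε)) T :=
    ⟨hJ, contDiff_fst.comp_contDiffOn hαs, fun s hs => h1 s hs ▸ (hα s hs).1.2,
      fun s hs => (hα s hs).1.1⟩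
  refine ⟨ε, θ, hε, by simp [hθ, hα₀], hrep, fun s hs => ?_⟩
  have hcθ := hc.comp hrep
  have hsT : θ s ∈ T := hrep.mapsTo hs
  have hp := hrep.deriv_pos s hs
  have hu0 : deriv c (θ s) ≠ 0 := ne_zero_of_dot_ne_zero (hc.nonnull _ hsT)
  -- Along the velocity the force is the derivative of the constant curvature; along the rotated
  -- velocity it vanishes by the choice of `H`.
  refine forceForm_eq_zero (n := deriv (c ∘ θ) s) (a := rot (deriv c (θ s))) ?_ ?_ ?_
  · rw [hc.deriv_comp hrep hs]
    have := mul_pos hp (sq_add_sq_pos hu0)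
    simp [rot]
    nlinarith
  · have hk : curveCurvature G (c ∘ θ) =ᶠ[nhds s] fun _ => κ := by
      filter_upwards [hJ.mem_nhds hs] with r hr
      rw [hc.curveCurvature_comp hrep hr, hκ _ (hrep.mapsTo hr)]
    exact (hcθ.hasDerivAt_curveCurvature h hs m).unique
      ((hasDerivAt_const s κ).congr_of_eventuallyEq hk)
  · rw [hc.covD_deriv_comp hrep hs, hc.covD_covD_deriv_comp hrep hs h, hc.deriv_comp hrep hs,
      Function.comp_apply, h3 s hs]
    have hz : H (α s) • deriv c (θ s) =
        (H (α s) / deriv θ s) • (deriv θ s • deriv c (θ s)) := by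
      rw [smul_smul, div_mul_cancel₀ _ hp.ne']
    have hN : vnorm G (c (θ s)) (deriv θ s • deriv c (θ s)) ≠ 0 := by
      have := vnorm_ne_zero (hcθ.nonnull s hs)
      rwa [hc.deriv_comp hrep hs] at this
    have hHe : H (α s) = forceForm m G (c (θ s)) (deriv θ s • deriv c (θ s))
      (deriv (deriv θ) s • deriv c (θ s) + deriv θ s ^ 2 • covD G c (deriv c) (θ s))
      ((3 * deriv θ s * deriv (deriv θ) s) • covD G c (deriv c) (θ s)
        + deriv θ s ^ 3 • covD G c (covD G c (deriv c)) (θ s)) (rot (deriv c (θ s)))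
      * vnorm G (c (θ s)) (deriv θ s • deriv c (θ s)) ^ 3
        / area G (c (θ s)) (deriv c (θ s)) (rot (deriv c (θ s))) := by
      rw [h1 s hs, h2 s hs]
    rw [hz, forceForm_add_smul, area_smul_left, hHe]
    have := harea _ hsT
    field_simp
    ring

end LocalCurve
/-! ### Orientation-preserving isometries between coordinate domains -/

/-- `Φ` is a smooth orientation-preserving local isometry from `(U₁, G₁)` to `(U₂, G₂)`. -/
structure LocalIsometry (G₁ : R2 → Matrix (Fin 2) (Fin 2) ℝ) (U₁ : Set R2)
    (G₂ : R2 → Matrix (Fin 2) (Fin 2) ℝ) (U₂ : Set R2) (Φ : R2 → R2) : Prop where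
  left : LocalMetric G₁ U₁
  right : LocalMetric G₂ U₂
  smooth : ContDiffOn ℝ ∞ Φ U₁
  mapsTo : ∀ y ∈ U₁, Φ y ∈ U₂
  det_pos : ∀ y ∈ U₁, 0 < (fderiv ℝ Φ y).det
  comp_eq : ∀ y ∈ U₁, ∀ i j,
    G₁ y i j = dot G₂ (Φ y) (fderiv ℝ Φ y (std i)) (fderiv ℝ Φ y (std j))

theorem two_le_infty : minSmoothness ℝ 2 ≤ (∞ : WithTop ℕ∞) := by
  simp only [minSmoothness_of_isRCLikeNormedField]
  exact WithTop.coe_le_coe.2 (le_top : (2 : ℕ∞) ≤ ⊤)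

theorem det_eq (L : R2 →L[ℝ] R2) :
    L.det = L (std 0) 0 * L (std 1) 1 - L (std 1) 0 * L (std 0) 1 := by
  have : L.det = LinearMap.det (L : R2 →ₗ[ℝ] R2) := rfl
  rw [this, ← LinearMap.det_toMatrix (EuclideanSpace.basisFun (Fin 2) ℝ).toBasis,
    Matrix.det_fin_two]
  simp [LinearMap.toMatrix_apply]

theorem map_apply_eq (L : R2 →L[ℝ] R2) (a : R2) (i : Fin 2) :
    L a i = a 0 * L (std 0) i + a 1 * L (std 1) i := by
  conv_lhs => rw [R2.eq_sum a]
  simp only [map_add, map_smul, PiLp.add_apply, PiLp.smul_apply, smul_eq_mul]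

theorem hasDerivAt_fderiv_apply {f : R2 → R2} {y v : ℝ → R2} {y' v' : R2} {t : ℝ}
    (hf : ContDiffAt ℝ ∞ f (y t)) (hy : HasDerivAt y y' t) (hv : HasDerivAt v v' t) :
    HasDerivAt (fun s => fderiv ℝ f (y s) (v s))
      (fderiv ℝ (fderiv ℝ f) (y t) y' (v t) + fderiv ℝ f (y t) v') t :=
  (((hf.fderiv_right (m := ∞) (by simp)).differentiableAt
    (by simp)).hasFDerivAt.comp_hasDerivAt t hy).clm_apply hv

theorem LocalMetric.eq_zero_of_dot {G : R2 → Matrix (Fin 2) (Fin 2) ℝ} {U : Set R2}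
    (h : LocalMetric G U) {y : R2} (hy : y ∈ U) {a : R2} (ha : ∀ b, dot G y a b = 0) : a = 0 := by
  have hdet := h.det_ne y hy
  rw [Matrix.det_fin_two] at hdet
  have h0 := ha (std 0)
  have h1 := ha (std 1)
  simp only [dot_expand, std_zero_zero, std_zero_one, std_one_zero, std_one_one] at h0 h1
  ext i
  refine (mul_eq_zero.1 (?_ : (G y 0 0 * G y 1 1 - G y 0 1 * G y 1 0) * a i = 0)).resolve_left hdet
  fin_cases i
  · simp only [Fin.zero_eta]; linear_combination G y 1 1 * h0 - G y 1 0 * h1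
  · simp only [Fin.mk_one]; linear_combination G y 0 0 * h1 - G y 0 1 * h0

namespace LocalIsometry

variable {G₁ G₂ : R2 → Matrix (Fin 2) (Fin 2) ℝ} {U₁ U₂ : Set R2} {Φ : R2 → R2}
  (H : LocalIsometry G₁ U₁ G₂ U₂ Φ)
include H

theorem contDiffAt {y : R2} (hy : y ∈ U₁) : ContDiffAt ℝ ∞ Φ y :=
  H.smooth.contDiffAt (H.left.isOpen.mem_nhds hy)

theorem contDiffAt_fderiv {y : R2} (hy : y ∈ U₁) : ContDiffAt ℝ ∞ (fderiv ℝ Φ) y :=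
  (H.contDiffAt hy).fderiv_right (by simp)

theorem dot_map {y : R2} (hy : y ∈ U₁) (a b : R2) :
    dot G₁ y a b = dot G₂ (Φ y) (fderiv ℝ Φ y a) (fderiv ℝ Φ y b) := by
  rw [dot_expand G₁]
  simp only [H.comp_eq y hy, dot_expand G₂, map_apply_eq _ a, map_apply_eq _ b]
  ring

/-- Determinants scale by the squared Jacobian; its positivity gives the square root without an
absolute value, so areas keep their sign. -/
theorem density_map {y : R2} (hy : y ∈ U₁) :
    density G₁ y = (fderiv ℝ Φ y).det * density G₂ (Φ y) := by
  have : (G₁ y).det = (fderiv ℝ Φ y).det * (fderiv ℝ Φ y).det * (G₂ (Φ y)).det := by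
    simp only [Matrix.det_fin_two, H.comp_eq y hy, dot_expand, det_eq]
    ring
  rw [density, this, abs_mul, Real.sqrt_mul (abs_nonneg _), abs_mul_self,
    Real.sqrt_mul_self (H.det_pos y hy).le, density]

theorem area_map {y : R2} (hy : y ∈ U₁) (a b : R2) :
    area G₁ y a b = area G₂ (Φ y) (fderiv ℝ Φ y a) (fderiv ℝ Φ y b) := by
  rw [area_expand, area_expand, H.density_map hy, det_eq]
  simp only [map_apply_eq _ a, map_apply_eq _ b]
  ring

theorem vnorm_map {y : R2} (hy : y ∈ U₁) (a : R2) :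
    vnorm G₁ y a = vnorm G₂ (Φ y) (fderiv ℝ Φ y a) := by
  rw [vnorm, vnorm, H.dot_map hy]

theorem exists_map_eq {y : R2} (hy : y ∈ U₁) (b : R2) : ∃ a, fderiv ℝ Φ y a = b :=
  ⟨((fderiv ℝ Φ y).toContinuousLinearEquivOfDetNeZero (H.det_pos y hy).ne').symm b,
    ((fderiv ℝ Φ y).toContinuousLinearEquivOfDetNeZero (H.det_pos y hy).ne').apply_symm_apply b⟩

theorem snd_symm {y : R2} (hy : y ∈ U₁) (a b : R2) :
    fderiv ℝ (fderiv ℝ Φ) y a b = fderiv ℝ (fderiv ℝ Φ) y b a :=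
  ((H.contDiffAt hy).isSymmSndFDerivAt two_le_infty).eq a b

section Path

variable {y v : ℝ → R2} {y' v' : R2} {t : ℝ} (hyU : y t ∈ U₁) (hy : HasDerivAt y y' t)
include hyU hy

theorem hasDerivAt_comp : HasDerivAt (fun s => Φ (y s)) (fderiv ℝ Φ (y t) y') t :=
  ((H.contDiffAt hyU).differentiableAt (by simp)).hasFDerivAt.comp_hasDerivAt t hy

theorem hasDerivAt_map (hv : HasDerivAt v v' t) : HasDerivAt (fun s => fderiv ℝ Φ (y s) (v s))
    (fderiv ℝ (fderiv ℝ Φ) (y t) y' (v t) + fderiv ℝ Φ (y t) v') t :=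
  hasDerivAt_fderiv_apply (H.contDiffAt hyU) hy hv

end Path

/-- The transformation law of the Christoffel symbols. -/
theorem map_chr {y : R2} (hy : y ∈ U₁) (a b : R2) : fderiv ℝ Φ y (chr G₁ y a b) =
    chr G₂ (Φ y) (fderiv ℝ Φ y a) (fderiv ℝ Φ y b) + fderiv ℝ (fderiv ℝ Φ) y a b := by
  set S : R2 → R2 → R2 := fun a b =>
    chr G₂ (Φ y) (fderiv ℝ Φ y a) (fderiv ℝ Φ y b) + fderiv ℝ (fderiv ℝ Φ) y a b with hS
  -- The defect of the transformation law. It is symmetric in its first two slots since both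
  -- connections are torsion free, and skew in the last two by metric compatibility, hence zero: the
  -- uniqueness argument for the Levi-Civita connection.
  set f : R2 → R2 → R2 → ℝ := fun a b e =>
    dot G₁ y (chr G₁ y a b) e - dot G₂ (Φ y) (S a b) (fderiv ℝ Φ y e) with hf
  have hsymm : ∀ a b e, f a b e = f b a e := fun a b e => by
    simp only [hf, hS, H.left.chr_comm y a b, H.snd_symm hy a b,
      H.right.chr_comm (Φ y) (fderiv ℝ Φ y a)]
  have hskew : ∀ a b e, f a b e = -f a e b := fun a b e => by
    have hs : HasDerivAt (fun s : ℝ => y + s • a) a 0 := by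
      simpa using ((hasDerivAt_id (0 : ℝ)).smul_const a).const_add y
    have hy0 : y + (0 : ℝ) • a ∈ U₁ := by simpa using hy
    have h1 := H.left.hasDerivAt_dot hy0 hs (hasDerivAt_const (0 : ℝ) b)
      (hasDerivAt_const (0 : ℝ) e)
    have h2 := H.right.hasDerivAt_dot (H.mapsTo _ hy0) (H.hasDerivAt_comp hy0 hs)
      (H.hasDerivAt_map hy0 hs (hasDerivAt_const (0 : ℝ) b))
      (H.hasDerivAt_map hy0 hs (hasDerivAt_const (0 : ℝ) e))
    have hev : (fun s : ℝ => dot G₁ (y + s • a) b e) =ᶠ[nhds 0] fun s =>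
        dot G₂ (Φ (y + s • a)) (fderiv ℝ Φ (y + s • a) b) (fderiv ℝ Φ (y + s • a) e) := by
      filter_upwards [hs.continuousAt.preimage_mem_nhds (H.left.isOpen.mem_nhds hy0)] with s hs
      exact H.dot_map hs b e
    have h3 := h1.unique (h2.congr_of_eventuallyEq hev)
    simp only [zero_smul, add_zero, map_zero, zero_add] at h3
    simp only [hf, hS, add_comm (chr G₂ _ _ _)]
    rw [H.left.dot_comm y b] at h3
    rw [H.right.dot_comm _ (fderiv ℝ Φ y b)] at h3
    linear_combination h3
  have hzero : ∀ a b e, f a b e = 0 := fun a b e => by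
    linarith [hskew a b e, hsymm a e b, hskew e a b, hsymm e b a, hskew b e a, hsymm b a e]
  refine sub_eq_zero.1 (H.right.eq_zero_of_dot (H.mapsTo y hy) fun w => ?_)
  obtain ⟨e, rfl⟩ := H.exists_map_eq hy w
  have := hzero a b e
  simp only [hf, H.dot_map hy] at this
  rw [sub_eq_add_neg, dot_add_left, ← neg_one_smul ℝ, dot_smul_left]
  linarith

/-- The transformation law of the covariant derivative along a curve. -/
theorem covD_map {c V : ℝ → R2} {t : ℝ} (ht : c t ∈ U₁) (hc : DifferentiableAt ℝ c t)
    (hV : DifferentiableAt ℝ V t) :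
    covD G₂ (Φ ∘ c) (fun s => fderiv ℝ Φ (c s) (V s)) t = fderiv ℝ Φ (c t) (covD G₁ c V t) := by
  have h1 : deriv (Φ ∘ c) t = fderiv ℝ Φ (c t) (deriv c t) :=
    (H.hasDerivAt_comp ht hc.hasDerivAt).deriv
  rw [covD_eq, covD_eq, (H.hasDerivAt_map ht hc.hasDerivAt hV.hasDerivAt).deriv, h1, map_add,
    H.map_chr ht]
  simp only [Function.comp_apply]
  abel

/-- The derivative of `map_chr` in direction `e`. Freezing `b` writes the third derivative of `Φ` as
a second derivative of a plane-valued map. -/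
theorem map_dchr {y : R2} (hy : y ∈ U₁) (e a b : R2) : fderiv ℝ Φ y (dchr G₁ y e a b) =
    dchr G₂ (Φ y) (fderiv ℝ Φ y e) (fderiv ℝ Φ y a) (fderiv ℝ Φ y b)
      + chr G₂ (Φ y) (fderiv ℝ (fderiv ℝ Φ) y e a) (fderiv ℝ Φ y b)
      + chr G₂ (Φ y) (fderiv ℝ Φ y a) (fderiv ℝ (fderiv ℝ Φ) y e b)
      + fderiv ℝ (fderiv ℝ fun z => fderiv ℝ Φ z b) y e a
      - fderiv ℝ (fderiv ℝ Φ) y e (chr G₁ y a b) := by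
  have hs : HasDerivAt (fun s : ℝ => y + s • e) e 0 := by
    simpa using ((hasDerivAt_id (0 : ℝ)).smul_const e).const_add y
  have hy0 : y + (0 : ℝ) • e ∈ U₁ := by simpa using hy
  have ca := hasDerivAt_const (0 : ℝ) a
  have cb := hasDerivAt_const (0 : ℝ) b
  have h1 := H.hasDerivAt_map hy0 hs (H.left.hasDerivAt_chr hy0 hs ca cb)
  have hψ : ContDiffAt ℝ ∞ (fun z => fderiv ℝ Φ z b) (y + (0 : ℝ) • e) :=
    (H.contDiffAt_fderiv hy0).clm_apply contDiffAt_const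
  have h2 := hasDerivAt_fderiv_apply (y := fun s : ℝ => y + s • e) hψ hs ca
  have h4 := (H.right.hasDerivAt_chr (H.mapsTo _ hy0) (H.hasDerivAt_comp hy0 hs)
    (H.hasDerivAt_map hy0 hs ca) (H.hasDerivAt_map hy0 hs cb)).add h2
  have hev : (fun s : ℝ => fderiv ℝ Φ (y + s • e) (chr G₁ (y + s • e) a b)) =ᶠ[nhds 0]
      (fun s : ℝ => chr G₂ (Φ (y + s • e)) (fderiv ℝ Φ (y + s • e) a) (fderiv ℝ Φ (y + s • e) b))
        + fun s : ℝ => fderiv ℝ (fun z => fderiv ℝ Φ z b) (y + s • e) a := by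
    filter_upwards [hs.continuousAt.preimage_mem_nhds (H.left.isOpen.mem_nhds hy0)] with s hs
    have h5 : fderiv ℝ (fun z => fderiv ℝ Φ z b) (y + s • e) a =
        fderiv ℝ (fderiv ℝ Φ) (y + s • e) a b := by
      rw [fderiv_clm_apply ((H.contDiffAt_fderiv hs).differentiableAt (by simp))
        (differentiableAt_const _)]
      simp
    rw [Pi.add_apply, H.map_chr hs, h5]
  have h6 := h1.unique (h4.congr_of_eventuallyEq hev)
  simp only [zero_smul, add_zero, map_zero, chr_zero_left, chr_zero_right] at h6
  rw [← h6]
  abel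

/-- The transformation law of the curvature. -/
theorem map_curv {y : R2} (hy : y ∈ U₁) (a b v : R2) : fderiv ℝ Φ y (curv G₁ y a b v) =
    curv G₂ (Φ y) (fderiv ℝ Φ y a) (fderiv ℝ Φ y b) (fderiv ℝ Φ y v) := by
  -- The curvature is skew in `a`, `b`, so the symmetric third derivatives of `Φ` drop out.
  have hψ : fderiv ℝ (fderiv ℝ fun z => fderiv ℝ Φ z v) y b a =
      fderiv ℝ (fderiv ℝ fun z => fderiv ℝ Φ z v) y a b :=
    (((H.contDiffAt_fderiv hy).clm_apply
      (contDiffAt_const (c := v))).isSymmSndFDerivAt two_le_infty).eq b a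
  simp only [curv, map_add, map_sub, H.map_dchr hy, H.map_chr hy, chr_add_right, hψ,
    H.snd_symm hy b a]
  abel

variable {c : ℝ → R2} {T : Set ℝ} (hc : LocalCurve G₁ U₁ c T)
include hc

theorem deriv_comp {t : ℝ} (ht : t ∈ T) : deriv (Φ ∘ c) t = fderiv ℝ Φ (c t) (deriv c t) :=
  (H.hasDerivAt_comp (hc.mapsTo t ht) (hc.hasDerivAt_of_contDiffOn hc.smooth ht)).deriv

theorem covD_deriv_comp {t : ℝ} (ht : t ∈ T) : covD G₂ (Φ ∘ c) (deriv (Φ ∘ c)) t =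
    fderiv ℝ Φ (c t) (covD G₁ c (deriv c) t) := by
  have hev : deriv (Φ ∘ c) =ᶠ[nhds t] fun s => fderiv ℝ Φ (c s) (deriv c s) := by
    filter_upwards [hc.isOpen.mem_nhds ht] with s hs using H.deriv_comp hc hs
  rw [covD_congr hev, H.covD_map (hc.mapsTo t ht) (differentiableAt_of_isOpen hc.isOpen hc.smooth ht)
    (differentiableAt_of_isOpen hc.isOpen (hc.contDiffOn_deriv hc.smooth) ht)]

theorem covD_covD_deriv_comp {t : ℝ} (ht : t ∈ T) :
    covD G₂ (Φ ∘ c) (covD G₂ (Φ ∘ c) (deriv (Φ ∘ c))) t =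
      fderiv ℝ Φ (c t) (covD G₁ c (covD G₁ c (deriv c)) t) := by
  have hev : covD G₂ (Φ ∘ c) (deriv (Φ ∘ c)) =ᶠ[nhds t]
      fun s => fderiv ℝ Φ (c s) (covD G₁ c (deriv c) s) := by
    filter_upwards [hc.isOpen.mem_nhds ht] with s hs using H.covD_deriv_comp hc hs
  rw [covD_congr hev, H.covD_map (hc.mapsTo t ht) (differentiableAt_of_isOpen hc.isOpen hc.smooth ht)
    (differentiableAt_of_isOpen hc.isOpen
      (hc.contDiffOn_covD H.left (hc.contDiffOn_deriv hc.smooth)) ht)]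

/-- The signed Frenet curvature is invariant under orientation-preserving isometries. -/
theorem curveCurvature_map {t : ℝ} (ht : t ∈ T) :
    curveCurvature G₂ (Φ ∘ c) t = curveCurvature G₁ c t := by
  rw [curveCurvature_eq, curveCurvature_eq, H.covD_deriv_comp hc ht, H.deriv_comp hc ht,
    H.area_map (hc.mapsTo t ht), H.vnorm_map (hc.mapsTo t ht), Function.comp_apply]

/-- The expression `E^R` is covariant under orientation-preserving isometries. -/
theorem curveForce_map (m : ℝ) {t : ℝ} (ht : t ∈ T) (v : R2) :
    curveForce m G₂ (Φ ∘ c) t (fderiv ℝ Φ (c t) v) = curveForce m G₁ c t v := by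
  have hy := hc.mapsTo t ht
  simp only [curveForce, forceForm, H.covD_covD_deriv_comp hc ht, H.covD_deriv_comp hc ht,
    H.deriv_comp hc ht, Function.comp_apply, ← H.map_curv hy, ← H.area_map hy, ← H.dot_map hy,
    ← H.vnorm_map hy]

end LocalIsometry
/-! ### Charts of an oriented pseudo-Riemannian surface -/

theorem LocalMetric.mono {G : R2 → Matrix (Fin 2) (Fin 2) ℝ} {U U' : Set R2}
    (h : LocalMetric G U) (hU' : IsOpen U') (hsub : U' ⊆ U) : LocalMetric G U' :=
  ⟨hU', h.symm, fun i j => (h.smooth i j).mono hsub, fun y hy => h.det_ne y (hsub hy)⟩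

theorem LocalCurve.mono {G : R2 → Matrix (Fin 2) (Fin 2) ℝ} {U U' : Set R2} {c : ℝ → R2}
    {T T' : Set ℝ} (hc : LocalCurve G U c T) (hT' : IsOpen T') (hsub : T' ⊆ T)
    (hmap : ∀ t ∈ T', c t ∈ U') : LocalCurve G U' c T' :=
  ⟨hT', hc.smooth.mono hsub, hmap, fun t ht => hc.nonnull t (hsub ht)⟩

theorem LocalReparam.mono {θ : ℝ → ℝ} {J J' T T' : Set ℝ} (hθ : LocalReparam θ J T)
    (hJ' : IsOpen J') (hsub : J' ⊆ J) (hmap : Set.MapsTo θ J' T') : LocalReparam θ J' T' :=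
  ⟨hJ', hθ.smooth.mono hsub, fun s hs => hθ.deriv_pos s (hsub hs), hmap⟩

theorem covD_eventuallyEq {G : R2 → Matrix (Fin 2) (Fin 2) ℝ} {c c' V V' : ℝ → R2} {t : ℝ}
    (hc : c =ᶠ[nhds t] c') (hV : V =ᶠ[nhds t] V') : covD G c V =ᶠ[nhds t] covD G c' V' := by
  filter_upwards [hc, hc.deriv, hV, hV.deriv] with s h1 h2 h3 h4
  rw [covD_eq, covD_eq, h1, h2, h3, h4]

theorem curveCurvature_congr {G : R2 → Matrix (Fin 2) (Fin 2) ℝ} {c c' : ℝ → R2} {t : ℝ}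
    (hc : c =ᶠ[nhds t] c') : curveCurvature G c t = curveCurvature G c' t := by
  rw [curveCurvature, curveCurvature, hc.eq_of_nhds, hc.deriv.eq_of_nhds, hc.deriv.deriv.eq_of_nhds]

theorem curveForce_congr {G : R2 → Matrix (Fin 2) (Fin 2) ℝ} {c c' : ℝ → R2} {t : ℝ}
    (hc : c =ᶠ[nhds t] c') (m : ℝ) (v : R2) : curveForce m G c t v = curveForce m G c' t v := by
  have h1 := covD_eventuallyEq (G := G) hc hc.deriv
  rw [curveForce, curveForce, hc.eq_of_nhds, hc.deriv.eq_of_nhds, h1.eq_of_nhds,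
    (covD_eventuallyEq (G := G) hc h1).eq_of_nhds]

theorem mem_symm_trans_source {M : Type*} [TopologicalSpace M] (φ ψ : OpenPartialHomeomorph M R2) {y : R2} :
    y ∈ (φ.symm.trans ψ).source ↔ y ∈ φ.target ∧ φ.symm y ∈ ψ.source := by
  rw [OpenPartialHomeomorph.trans_source]; rfl

variable {M : Type*} [TopologicalSpace M] [ChartedSpace R2 M]

theorem mdifferentiable_of_mem_maximalAtlas [IsManifold 𝓘(ℝ, R2) ∞ M]
    {φ : OpenPartialHomeomorph M R2} (hφ : φ ∈ IsManifold.maximalAtlas 𝓘(ℝ, R2) ∞ M) :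
    φ.MDifferentiable 𝓘(ℝ, R2) 𝓘(ℝ, R2) :=
  ⟨(contMDiffOn_of_mem_maximalAtlas hφ).mdifferentiableOn (by simp),
    (contMDiffOn_symm_of_mem_maximalAtlas hφ).mdifferentiableOn (by simp)⟩

/-- The derivative of the inverse of a chart, as a map from the coordinate plane. -/
noncomputable def chartInvDeriv (φ : OpenPartialHomeomorph M R2) (y : R2) : R2 →L[ℝ] R2 :=
  mfderiv 𝓘(ℝ, R2) 𝓘(ℝ, R2) φ.symm y

namespace PseudoMetric

variable (g : PseudoMetric M)

/-- The metric at `x`, on the model space of the tangent space. -/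
def form (x : M) : LinearMap.BilinForm ℝ R2 := g.val x

theorem comp_apply (φ : OpenPartialHomeomorph M R2) (y : R2) (i j : Fin 2) : g.comp φ y i j =
    g.form (φ.symm y) (chartInvDeriv φ y (std i)) (chartInvDeriv φ y (std j)) := rfl

theorem dot_comp (φ : OpenPartialHomeomorph M R2) (y a b : R2) : dot (g.comp φ) y a b =
    g.form (φ.symm y) (chartInvDeriv φ y a) (chartInvDeriv φ y b) := by
  rw [dot_expand]
  simp only [comp_apply]
  conv_rhs => rw [R2.eq_sum a, R2.eq_sum b]
  simp only [map_add, map_smul, LinearMap.add_apply, LinearMap.smul_apply, smul_eq_mul]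
  ring

variable [IsManifold 𝓘(ℝ, R2) ∞ M]

theorem localMetric {φ : OpenPartialHomeomorph M R2}
    (hφ : φ ∈ IsManifold.maximalAtlas 𝓘(ℝ, R2) ∞ M) : LocalMetric (g.comp φ) φ.target where
  isOpen := φ.open_target
  symm y i j := g.symm _ _ _
  smooth i j := g.smooth φ hφ i j
  det_ne y hy hdet := by
    -- A kernel vector of the matrix would be orthogonal to everything, since the derivative of the
    -- inverse chart is onto.
    obtain ⟨v, hv0, hv⟩ := Matrix.exists_vecMul_eq_zero_iff.2 hdet
    have hbij : Function.Bijective (chartInvDeriv φ y) :=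
      (mdifferentiable_of_mem_maximalAtlas hφ).symm.mfderiv_bijective hy
    set a : R2 := WithLp.toLp 2 v with ha
    have h0 : ∀ b, dot (g.comp φ) y a b = 0 := fun b => by
      have e0 := congrFun hv 0
      have e1 := congrFun hv 1
      simp only [Matrix.vecMul, dotProduct, Fin.sum_univ_two, Pi.zero_apply] at e0 e1
      rw [dot_expand]
      simp only [ha]
      linear_combination b 0 * e0 + b 1 * e1
    have h1 : chartInvDeriv φ y a = 0 := by
      refine g.nondegenerate (φ.symm y) _ fun w => ?_
      obtain ⟨b, hb⟩ := hbij.2 w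
      have := h0 b
      rw [dot_comp, hb] at this
      exact this
    have h2 : a = 0 := hbij.1 (h1.trans (map_zero _).symm)
    exact hv0 (by simpa [ha] using h2)

theorem localIsometry (o : OrientedAtlas M) {φ ψ : OpenPartialHomeomorph M R2}
    (hφ : φ ∈ o.charts) (hψ : ψ ∈ o.charts) :
    LocalIsometry (g.comp φ) (φ.symm.trans ψ).source (g.comp ψ) ψ.target (φ.symm.trans ψ) where
  left := (g.localMetric (o.smooth hφ)).mono (φ.symm.trans ψ).open_source fun y hy =>
    ((mem_symm_trans_source φ ψ).1 hy).1
  right := g.localMetric (o.smooth hψ)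
  smooth := by
    rw [← contMDiffOn_iff_contDiffOn]
    exact (contMDiffOn_of_mem_maximalAtlas (o.smooth hψ)).comp
      ((contMDiffOn_symm_of_mem_maximalAtlas (o.smooth hφ)).mono fun y hy =>
        ((mem_symm_trans_source φ ψ).1 hy).1)
      fun y hy => ((mem_symm_trans_source φ ψ).1 hy).2
  mapsTo y hy := ψ.map_source ((mem_symm_trans_source φ ψ).1 hy).2
  det_pos := o.det_pos φ hφ ψ hψ
  comp_eq y hy i j := by
    have hmem : ∀ z ∈ (φ.symm.trans ψ).source, φ.symm z = ψ.symm ((φ.symm.trans ψ) z) :=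
      fun z hz => (ψ.left_inv ((mem_symm_trans_source φ ψ).1 hz).2).symm
    have hdφ := mdifferentiable_of_mem_maximalAtlas (o.smooth hφ)
    have hdψ := mdifferentiable_of_mem_maximalAtlas (o.smooth hψ)
    have hev : φ.symm =ᶠ[nhds y] ψ.symm ∘ (φ.symm.trans ψ) :=
      Filter.eventually_of_mem ((φ.symm.trans ψ).open_source.mem_nhds hy) hmem
    have hy' : (φ.symm.trans ψ) y ∈ ψ.target :=
      ψ.map_source ((mem_symm_trans_source φ ψ).1 hy).2
    -- Chain rule for `φ⁻¹ = ψ⁻¹ ∘ (ψ ∘ φ⁻¹)`: both component matrices are pullbacks of the same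
    -- form.
    have hD : chartInvDeriv φ y =
        (chartInvDeriv ψ ((φ.symm.trans ψ) y)).comp (fderiv ℝ (φ.symm.trans ψ) y) := by
      have h1 := hev.mfderiv_eq (I := 𝓘(ℝ, R2)) (I' := 𝓘(ℝ, R2))
      have h2 := mfderiv_comp y (hdψ.mdifferentiableAt_symm hy')
        ((hdφ.symm.trans hdψ).mdifferentiableAt hy)
      rw [mfderiv_eq_fderiv] at h2
      exact h1.trans h2
    rw [comp_apply, dot_comp, hD, hmem y hy]
    rfl

end PseudoMetric

/-! ### Curves on the surface and independence of the chart -/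

namespace IsRegularCurve

variable [IsManifold 𝓘(ℝ, R2) ∞ M] {g : PseudoMetric M} {o : OrientedAtlas M} {γ : ℝ → M}
  {I : Set ℝ} (hγ : IsRegularCurve g o γ I) (hI : IsOpen I)
include hγ hI

omit [IsManifold 𝓘(ℝ, R2) ∞ M] in
theorem isOpen_inter_preimage {s : Set M} (hs : IsOpen s) : IsOpen (I ∩ γ ⁻¹' s) :=
  hγ.smooth.continuousOn.isOpen_inter_preimage hI hs

omit [IsManifold 𝓘(ℝ, R2) ∞ M] in
theorem localCurve {φ : OpenPartialHomeomorph M R2} (hφ : φ ∈ o.charts) :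
    LocalCurve (g.comp φ) φ.target (φ ∘ γ) (I ∩ γ ⁻¹' φ.source) where
  isOpen := hγ.isOpen_inter_preimage hI φ.open_source
  smooth := by
    rw [← contMDiffOn_iff_contDiffOn]
    exact (contMDiffOn_of_mem_maximalAtlas (o.smooth hφ)).comp
      (hγ.smooth.mono Set.inter_subset_left) fun t ht => ht.2
  mapsTo t ht := φ.map_source ht.2
  nonnull t ht := hγ.nonnull φ hφ t ht.1 ht.2

variable {φ ψ : OpenPartialHomeomorph M R2} (hφ : φ ∈ o.charts) (hψ : ψ ∈ o.charts)
include hφ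

theorem eulerPoisson_eq_curveForce (m : ℝ) {t : ℝ} (ht : t ∈ I) (htφ : γ t ∈ φ.source)
    (i : Fin 2) : eulerPoisson (lagrangian m (g.comp φ)) (φ ∘ γ) t i =
      curveForce m (g.comp φ) (φ ∘ γ) t (std i) := by
  rw [(hγ.localCurve hI hφ).eulerPoisson_eq (g.localMetric (o.smooth hφ)) ⟨ht, htφ⟩,
    eulerPoissonR_eq]

theorem hasDerivAt_curvatureAt (m : ℝ) {t : ℝ} (ht : t ∈ I) (htφ : γ t ∈ φ.source) :
    HasDerivAt (curvatureAt g φ γ)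
      (curveForce m (g.comp φ) (φ ∘ γ) t (deriv (φ ∘ γ) t)) t :=
  (hγ.localCurve hI hφ).hasDerivAt_curveCurvature (g.localMetric (o.smooth hφ)) ⟨ht, htφ⟩ m

omit [IsManifold 𝓘(ℝ, R2) ∞ M] in
theorem localCurve_inter (ψ : OpenPartialHomeomorph M R2) : LocalCurve (g.comp φ) (φ.symm.trans ψ).source (φ ∘ γ)
    (I ∩ γ ⁻¹' (φ.source ∩ ψ.source)) :=
  (hγ.localCurve hI hφ).mono
    (hγ.isOpen_inter_preimage hI (φ.open_source.inter ψ.open_source))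
    (fun t ht => ⟨ht.1, ht.2.1⟩) fun t ht => by
      rw [mem_symm_trans_source]
      refine ⟨φ.map_source ht.2.1, ?_⟩
      rw [Function.comp_apply, φ.left_inv ht.2.1]
      exact ht.2.2

omit [IsManifold 𝓘(ℝ, R2) ∞ M] in
theorem trans_comp_eventuallyEq (ψ : OpenPartialHomeomorph M R2) {t : ℝ} (ht : t ∈ I) (htφ : γ t ∈ φ.source)
    (htψ : γ t ∈ ψ.source) : (φ.symm.trans ψ) ∘ (φ ∘ γ) =ᶠ[nhds t] ψ ∘ γ := by
  filter_upwards [(hγ.localCurve_inter hI hφ ψ).isOpen.mem_nhds ⟨ht, htφ, htψ⟩] with s hs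
  simp [φ.left_inv hs.2.1]

include hψ

/-- The signed Frenet curvature does not depend on the chart of the oriented atlas. -/
theorem curvatureAt_eq {t : ℝ} (ht : t ∈ I) (htφ : γ t ∈ φ.source) (htψ : γ t ∈ ψ.source) :
    curvatureAt g ψ γ t = curvatureAt g φ γ t := by
  have h1 := (g.localIsometry o hφ hψ).curveCurvature_map (hγ.localCurve_inter hI hφ ψ)
    (t := t) ⟨ht, htφ, htψ⟩
  rwa [curveCurvature_congr (hγ.trans_comp_eventuallyEq hI hφ ψ ht htφ htψ)] at h1

/-- The vanishing of `E^R` does not depend on the chart of the oriented atlas. -/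
theorem curveForce_eq_zero {m t : ℝ} (ht : t ∈ I) (htφ : γ t ∈ φ.source) (htψ : γ t ∈ ψ.source)
    (h0 : ∀ v, curveForce m (g.comp φ) (φ ∘ γ) t v = 0) (w : R2) :
    curveForce m (g.comp ψ) (ψ ∘ γ) t w = 0 := by
  have hc := hγ.localCurve_inter hI hφ ψ
  have hiso := g.localIsometry o hφ hψ
  have ht' : t ∈ I ∩ γ ⁻¹' (φ.source ∩ ψ.source) := ⟨ht, htφ, htψ⟩
  obtain ⟨v, rfl⟩ := hiso.exists_map_eq (hc.mapsTo t ht') w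
  rw [← curveForce_congr (hγ.trans_comp_eventuallyEq hI hφ ψ ht htφ htψ),
    hiso.curveForce_map hc m ht', h0]

omit hφ hψ

/-- The charts `χ t` are chosen pointwise, without any continuity. Chart independence makes `k`
agree near each point with the curvature in one fixed chart, so `k' = 0` and `k` is constant on the
connected `I`. -/
theorem isGeodesicCircle_of_hasDerivAt (hI' : IsPreconnected I)
    (h0 : ∀ t ∈ I, ∃ φ ∈ o.charts, γ t ∈ φ.source ∧ HasDerivAt (curvatureAt g φ γ) 0 t) :
    IsGeodesicCircle g o γ I := by
  choose χ hχ hχs using fun t : ℝ => o.cover (γ t)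
  set k : ℝ → ℝ := fun t => curvatureAt g (χ t) γ t with hk
  have hd : ∀ t ∈ I, HasDerivAt k 0 t := fun t ht => by
    obtain ⟨φ, hφ, htφ, hd⟩ := h0 t ht
    refine hd.congr_of_eventuallyEq ?_
    filter_upwards [(hγ.localCurve hI hφ).isOpen.mem_nhds ⟨ht, htφ⟩] with s hs
    exact hγ.curvatureAt_eq hI hφ (hχ s) hs.1 hs.2 (hχs s)
  obtain ⟨κ, hκ⟩ := hI.exists_is_const_of_deriv_eq_zero hI'
    (fun t ht => (hd t ht).differentiableAt.differentiableWithinAt) fun t ht => (hd t ht).deriv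
  exact ⟨hγ, κ, fun φ hφ t ht htφ =>
    (hγ.curvatureAt_eq hI (hχ t) hφ ht (hχs t) htφ).trans (hκ t ht)⟩

omit hI

omit [IsManifold 𝓘(ℝ, R2) ∞ M] in
theorem comp {θ : ℝ → ℝ} {J : Set ℝ} (hI : IsOpen I) (hθ : LocalReparam θ J I) :
    IsRegularCurve g o (γ ∘ θ) J where
  smooth := hγ.smooth.comp (contMDiffOn_iff_contDiffOn.2 hθ.smooth) hθ.mapsTo
  nonnull φ hφ s hs hsφ := by
    have hc := hγ.localCurve hI hφ
    have hJ' : IsOpen (J ∩ θ ⁻¹' (I ∩ γ ⁻¹' φ.source)) :=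
      hθ.smooth.continuousOn.isOpen_inter_preimage hθ.isOpen hc.isOpen
    have hθ' := hθ.mono hJ' Set.inter_subset_left (T' := I ∩ γ ⁻¹' φ.source) fun r hr => hr.2
    exact (hc.comp hθ').nonnull s ⟨hs, hθ.mapsTo hs, hsφ⟩

end IsRegularCurve

theorem IsExtremal.hasDerivAt_curvatureAt [IsManifold 𝓘(ℝ, R2) ∞ M] {g : PseudoMetric M}
    {o : OrientedAtlas M} {m : ℝ} {γ : ℝ → M} {I : Set ℝ} (hγ : IsExtremal m g o γ I)
    (hI : IsOpen I) {φ : OpenPartialHomeomorph M R2} (hφ : φ ∈ o.charts) {t : ℝ} (ht : t ∈ I)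
    (htφ : γ t ∈ φ.source) : HasDerivAt (curvatureAt g φ γ) 0 t := by
  have hE : ∀ i, curveForce m (g.comp φ) (φ ∘ γ) t (std i) = 0 := fun i => by
    rw [← hγ.regular.eulerPoisson_eq_curveForce hI hφ m ht htφ, hγ.eq_zero φ hφ t ht htφ]
  have h0 := forceForm_eq_zero (n := std 0) (a := std 1) (by simp [std]) (hE 0) (hE 1)
  have := hγ.regular.hasDerivAt_curvatureAt hI hφ m ht htφ
  rwa [curveForce, h0] at this

end Concircular

/-! ### The main theorem -/

theorem mainTheorem1 {M : Type*} [TopologicalSpace M] [ChartedSpace Concircular.R2 M]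
    [IsManifold 𝓘(ℝ, Concircular.R2) ∞ M]
    (g : Concircular.PseudoMetric M) (o : Concircular.OrientedAtlas M) (m : ℝ)
    (γ : ℝ → M) (I : Set ℝ) (hI : IsOpen I) (hI' : IsPreconnected I)
    (hγ : Concircular.IsRegularCurve g o γ I) :
    (∀ φ ∈ o.charts, ∀ t ∈ I, γ t ∈ φ.source → ∀ j,
      Concircular.eulerPoisson (Concircular.lagrangian m (g.comp φ)) (φ ∘ γ) t j
        = Concircular.eulerPoissonR m (g.comp φ) (φ ∘ γ) t j) ∧
    (Concircular.IsExtremal m g o γ I → Concircular.IsGeodesicCircle g o γ I) ∧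
    (Concircular.IsGeodesicCircle g o γ I ↔
      ∀ t₀ ∈ I, ∃ (J : Set ℝ) (θ : ℝ → ℝ), IsOpen J ∧ IsPreconnected J ∧
        ContDiffOn ℝ ∞ θ J ∧ (∀ s ∈ J, 0 < deriv θ s) ∧ Set.MapsTo θ J I ∧ t₀ ∈ θ '' J ∧
        Concircular.IsExtremal m g o (γ ∘ θ) J) := by
  open Concircular in
  refine ⟨fun φ hφ t ht htφ j => (hγ.localCurve hI hφ).eulerPoisson_eq
    (g.localMetric (o.smooth hφ)) ⟨ht, htφ⟩ m j, fun hE => ?_, fun hC t₀ ht₀ => ?_, fun hR => ?_⟩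
  · refine hγ.isGeodesicCircle_of_hasDerivAt hI hI' fun t ht => ?_
    obtain ⟨φ, hφ, htφ⟩ := o.cover (γ t)
    exact ⟨φ, hφ, htφ, hE.hasDerivAt_curvatureAt hI hφ ht htφ⟩
  · obtain ⟨κ, hκ⟩ := hC.const
    obtain ⟨φ, hφ, htφ⟩ := o.cover (γ t₀)
    have hc := hγ.localCurve hI hφ
    obtain ⟨ε, θ, hε, hθ₀, hθ, hzero⟩ := hc.exists_reparam (g.localMetric (o.smooth hφ)) m
      (fun t ht => hκ φ hφ t ht.1 ht.2) ⟨ht₀, htφ⟩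
    have hθI : LocalReparam θ (Set.Ioo (t₀ - ε) (t₀ + ε)) I :=
      hθ.mono hθ.isOpen subset_rfl fun s hs => (hθ.mapsTo hs).1
    have hreg := hγ.comp hI hθI
    refine ⟨_, θ, hθ.isOpen, isPreconnected_Ioo, hθ.smooth, hθ.deriv_pos, hθI.mapsTo,
      ⟨t₀, ⟨by linarith, by linarith⟩, hθ₀⟩, hreg, fun ψ hψ s hs hsψ i => ?_⟩
    rw [hreg.eulerPoisson_eq_curveForce hθ.isOpen hψ m hs hsψ]
    -- The reparametrization was built in the single chart `φ`; covariance carries the vanishing to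
    -- every chart `ψ`.
    exact hreg.curveForce_eq_zero hθ.isOpen hφ hψ hs (hθ.mapsTo hs).2 hsψ (hzero s hs) _
  · refine hγ.isGeodesicCircle_of_hasDerivAt hI hI' fun t₀ ht₀ => ?_
    obtain ⟨J, θ, hJ, -, hθs, hθ', hmap, ⟨s₀, hs₀, hθ₀⟩, hE⟩ := hR t₀ ht₀
    obtain ⟨φ, hφ, htφ⟩ := o.cover (γ t₀)
    have hc := hγ.localCurve hI hφ
    have hG := g.localMetric (o.smooth hφ)
    have hθ : LocalReparam θ (J ∩ θ ⁻¹' (I ∩ γ ⁻¹' φ.source)) (I ∩ γ ⁻¹' φ.source) :=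
      ⟨hθs.continuousOn.isOpen_inter_preimage hJ hc.isOpen, hθs.mono Set.inter_subset_left,
        fun s hs => hθ' s hs.1, fun s hs => hs.2⟩
    have hs₀' : s₀ ∈ J ∩ θ ⁻¹' (I ∩ γ ⁻¹' φ.source) := by
      refine ⟨hs₀, ?_⟩
      rw [Set.mem_preimage, hθ₀]
      exact ⟨ht₀, htφ⟩
    have h1 : HasDerivAt (curvatureAt g φ (γ ∘ θ)) 0 s₀ :=
      hE.hasDerivAt_curvatureAt hJ hφ hs₀ hs₀'.2.2
    have h2 : HasDerivAt (curvatureAt g φ γ) _ (θ s₀) :=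
      hγ.hasDerivAt_curvatureAt hI hφ m hs₀'.2.1 hs₀'.2.2
    -- `k ∘ θ` is the curvature of the extremal `γ ∘ θ` and has zero derivative at `s₀`; as `θ' >
    -- 0`, the chain rule forces `k' = 0` at `t₀`.
    have h3 := h2.comp s₀ (differentiableAt_of_isOpen hJ hθs hs₀).hasDerivAt
    have hev : curvatureAt g φ (γ ∘ θ) =ᶠ[nhds s₀] curvatureAt g φ γ ∘ θ := by
      filter_upwards [hθ.isOpen.mem_nhds hs₀'] with s hs
      exact hc.curveCurvature_comp hθ hs
    have h4 := (h3.congr_of_eventuallyEq hev).unique h1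
    rw [(mul_eq_zero.1 h4).resolve_right (hθ' s₀ hs₀).ne', hθ₀] at h2
    exact ⟨φ, hφ, htφ, h2⟩
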